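/- All monoids are commutative and pointed, i.e. they have a unit $1$ and an absorbing element $0$. For a monoid $A$ let $\operatorname{MSpec}(A)$ be the space of prime ideals of $A$ with the Zariski topology and its structure sheaf, whose stalk at $\mathfrak p$ is the localization $A_{\mathfrak p}$. A monoid scheme is a topological space $X$ with a sheaf $\mathcal A$ of monoids which is locally isomorphic to $\operatorname{MSpec}(A)$ for suitable monoids $A$. An invertible sheaf on $X$ is a sheaf of $\mathcal A$-sets (a sheaf of pointed sets with an action of $\mathcal A$) which is locally isomorphic to $\mathcal A$, and $\operatorname{Pic}(X)$ is the abelian group of isomorphism classes of invertible sheaves on $X$ under the smash product $\mathcal L_1\wedge_{\mathcal A}\mathcal L_2$. Let $\mathbb A^1=\operatorname{MSpec}(T)$, where $T=\{0,1,t,t^2,\dots\}$ is the free monoid on one generator $t$, and let $X\times\mathbb A^1$ be the product monoid scheme, which is locally $\operatorname{MSpec}(A)\times\mathbb A^1=\operatorname{MSpec}(A\wedge T)$. **Corollary.** For every monoid scheme $X$, pull-back along the projection $p:X\times\mathbb A^1\to X$ induces an isomorphism of groups $$p^*:\operatorname{Pic}(X)\xrightarrow{\ \cong\ }\operatorname{Pic}(X\times\mathbb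 A^1),\qquad [\mathcal L]\mapsto[p^*\mathcal L].$$ -/

import Mathlib

universe u

namespace MonoidScheme

open CategoryTheory TopologicalSpace Opposite

noncomputable section

/-! ### Sheaves of sets on a topological space -/

section SheafAPI

variable {X : TopCat.{u}} (F : TopCat.Sheaf (Type u) X)

/-- Sections of the sheaf `F` over `U`. -/
abbrev Sec (U : Opens X) : Type u := F.presheaf.obj (op U)

/-- The stalk of `F` at `x`. -/
abbrev Stk (x : X) : Type u := F.presheaf.stalk x

variable {F}

/-- Restriction of sections. -/
def res {U V : Opens X} (h : U ≤ V) (s : Sec F V) : Sec F U :=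
  F.presheaf.map (homOfLE h).op s

/-- The germ of a section at a point. -/
def germ {U : Opens X} {x : X} (hx : x ∈ U) (s : Sec F U) : Stk F x :=
  F.presheaf.germ U x hx s

theorem res_res {U V W : Opens X} (h : U ≤ V) (h' : V ≤ W) (s : Sec F W) :
    res h (res h' s) = res (h.trans h') s := by
  unfold res
  rw [← ConcreteCategory.comp_apply, ← Functor.map_comp]
  rfl

theorem res_self {U : Opens X} (h : U ≤ U) (s : Sec F U) : res h s = s :=
  ConcreteCategory.congr_hom (F.presheaf.map_id (op U)) s

theorem germ_res {U V : Opens X} (h : U ≤ V) {x : X} (hx : x ∈ U) (s : Sec F V) :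
    germ hx (res h s) = germ (h hx) s :=
  F.presheaf.germ_res_apply (homOfLE h) x hx s

theorem exists_germ {x : X} (t : Stk F x) :
    ∃ (U : Opens X) (hx : x ∈ U) (s : Sec F U), germ hx s = t :=
  F.presheaf.exists_germ_eq t

theorem germ_eq {U V : Opens X} {x : X} {hU : x ∈ U} {hV : x ∈ V} {s : Sec F U} {t : Sec F V}
    (h : germ hU s = germ hV t) :
    ∃ (W : Opens X) (_ : x ∈ W) (iU : W ≤ U) (iV : W ≤ V), res iU s = res iV t := by
  obtain ⟨W, hW, iU, iV, e⟩ := F.presheaf.germ_eq x hU hV s t h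
  exact ⟨W, hW, iU.le, iV.le, e⟩

theorem sec_ext {U : Opens X} {s t : Sec F U} (h : ∀ x (hx : x ∈ U), germ hx s = germ hx t) :
    s = t :=
  TopCat.Presheaf.section_ext F U s t h

theorem glue {ι : Type u} {V : Opens X} (U : ι → Opens X) (hU : ∀ i, U i ≤ V)
    (hV : ∀ x ∈ V, ∃ i, x ∈ U i) (s : ∀ i, Sec F (U i))
    (hs : ∀ i j x (hi : x ∈ U i) (hj : x ∈ U j), germ hi (s i) = germ hj (s j)) :
    ∃ t : Sec F V, ∀ i, res (hU i) t = s i := by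
  obtain ⟨t, ht, -⟩ := F.existsUnique_gluing' U V (fun i => homOfLE (hU i))
    (fun x hx => by simpa using hV x hx) s (fun i j => sec_ext fun x hx => by
      refine (germ_res (F := F) (U := U i ⊓ U j) inf_le_left hx (s i)).trans ?_
      refine Eq.trans ?_ (germ_res (F := F) (U := U i ⊓ U j) inf_le_right hx (s j)).symm
      exact hs i j x hx.1 hx.2)
  exact ⟨t, ht⟩

/-- Two germs are represented by sections over a common neighbourhood. -/
theorem exists_germ₂ {G : TopCat.Sheaf (Type u) X} {x : X} (s : Stk F x) (t : Stk G x) :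
    ∃ (U : Opens X) (hx : x ∈ U) (a : Sec F U) (b : Sec G U), germ hx a = s ∧ germ hx b = t := by
  obtain ⟨U, hU, a, rfl⟩ := exists_germ s
  obtain ⟨V, hV, b, rfl⟩ := exists_germ t
  exact ⟨U ⊓ V, ⟨hU, hV⟩, res inf_le_left a, res inf_le_right b, germ_res _ _ _, germ_res _ _ _⟩

theorem exists_stalkMap₂ {G H : TopCat.Sheaf (Type u) X}
    (f : ∀ U, Sec F U → Sec G U → Sec H U)
    (hf : ∀ {U V : Opens X} (h : U ≤ V) (a : Sec F V) (b : Sec G V),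
      res h (f V a b) = f U (res h a) (res h b)) (x : X) :
    ∃ φ : Stk F x → Stk G x → Stk H x, ∀ (U : Opens X) (hx : x ∈ U) (a : Sec F U) (b : Sec G U),
      φ (germ hx a) (germ hx b) = germ hx (f U a b) := by
  choose U hU a b ha hb using fun (s : Stk F x) (t : Stk G x) => exists_germ₂ s t
  refine ⟨fun s t => germ (hU s t) (f _ (a s t) (b s t)), fun V hV a' b' => ?_⟩
  obtain ⟨W, hW, iU, iV, e⟩ := germ_eq (ha (germ hV a') (germ hV b'))
  obtain ⟨W', hW', iU', iV', e'⟩ := germ_eq (hb (germ hV a') (germ hV b'))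
  have hx : x ∈ W ⊓ W' := ⟨hW, hW'⟩
  dsimp only
  rw [← germ_res (inf_le_left.trans iV : W ⊓ W' ≤ V) hx (f V a' b'),
    ← germ_res (inf_le_left.trans iU : W ⊓ W' ≤ U (germ hV a') (germ hV b')) hx, hf, hf,
    ← res_res inf_le_left iV, ← e, res_res, ← res_res inf_le_right iV', ← e', res_res]

/-- The map on stalks induced by a natural pairing of sections. -/
def stalkMap₂ {G H : TopCat.Sheaf (Type u) X} (f : ∀ U, Sec F U → Sec G U → Sec H U)
    (hf : ∀ {U V : Opens X} (h : U ≤ V) (a : Sec F V) (b : Sec G V),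
      res h (f V a b) = f U (res h a) (res h b)) (x : X) : Stk F x → Stk G x → Stk H x :=
  (exists_stalkMap₂ f hf x).choose

theorem stalkMap₂_germ {G H : TopCat.Sheaf (Type u) X} (f : ∀ U, Sec F U → Sec G U → Sec H U)
    (hf : ∀ {U V : Opens X} (h : U ≤ V) (a : Sec F V) (b : Sec G V),
      res h (f V a b) = f U (res h a) (res h b)) {x : X} {U : Opens X} (hx : x ∈ U)
    (a : Sec F U) (b : Sec G U) :
    stalkMap₂ f hf x (germ hx a) (germ hx b) = germ hx (f U a b) :=
  (exists_stalkMap₂ f hf x).choose_spec U hx a b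

end SheafAPI

/-- The sheaf of those families `x ↦ f x ∈ T x` which locally satisfy `P`. -/
def fiberSheaf {X : TopCat.{u}} {T : X → Type u} (P : TopCat.PrelocalPredicate T) :
    TopCat.Sheaf (Type u) X :=
  TopCat.subsheafToTypes P.sheafify

section FiberSheaf

variable {X : TopCat.{u}} {T : X → Type u} {P : TopCat.PrelocalPredicate T}

/-- The value at `x` of a germ of `fiberSheaf P`. -/
def value (x : X) : Stk (fiberSheaf P) x → T x :=
  TopCat.stalkToFiber P.sheafify x

theorem value_germ {U : Opens X} {x : X} (hx : x ∈ U) (s : Sec (fiberSheaf P) U) :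
    value x (germ hx s) = s.1 ⟨x, hx⟩ :=
  TopCat.stalkToFiber_germ P.sheafify U x hx s

theorem res_val {U V : Opens X} (h : U ≤ V) (s : Sec (fiberSheaf P) V) (x : U) :
    (res h s).1 x = s.1 ⟨x.1, h x.2⟩ := rfl

end FiberSheaf

/-! ### Monoided spaces -/

/-- A topological space with a sheaf of pointed abelian monoids. -/
structure MonoidedSpace : Type (u + 1) where
  carrier : TopCat.{u}
  sheaf : TopCat.Sheaf (Type u) carrier
  [monoid : ∀ U : Opens carrier, CommMonoidWithZero (Sec sheaf U)]
  res_zero : ∀ {U V : Opens carrier} (h : U ≤ V), res h (0 : Sec sheaf V) = 0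
  res_one : ∀ {U V : Opens carrier} (h : U ≤ V), res h (1 : Sec sheaf V) = 1
  res_mul : ∀ {U V : Opens carrier} (h : U ≤ V) (a b : Sec sheaf V),
    res h (a * b) = res h a * res h b

attribute [instance] MonoidedSpace.monoid

namespace MonoidedSpace

variable (X : MonoidedSpace.{u})

/-- Sections of the structure sheaf. -/
abbrev Γ (U : Opens X.carrier) : Type u := Sec X.sheaf U

/-- Stalks of the structure sheaf. -/
abbrev stalk (x : X.carrier) : Type u := Stk X.sheaf x

/-- The stalks of the structure sheaf are pointed monoids. -/
instance (x : X.carrier) : Mul (X.stalk x) := ⟨stalkMap₂ (fun _ a b => a * b) X.res_mul x⟩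
instance (x : X.carrier) : One (X.stalk x) := ⟨germ (U := ⊤) trivial (1 : X.Γ ⊤)⟩
instance (x : X.carrier) : Zero (X.stalk x) := ⟨germ (U := ⊤) trivial (0 : X.Γ ⊤)⟩

variable {X}

theorem germ_mul {U : Opens X.carrier} {x : X.carrier} (hx : x ∈ U) (a b : X.Γ U) :
    germ hx (a * b) = germ hx a * germ hx b :=
  (stalkMap₂_germ (fun _ a b => a * b) X.res_mul hx a b).symm

theorem germ_one {U : Opens X.carrier} {x : X.carrier} (hx : x ∈ U) :
    germ hx (1 : X.Γ U) = 1 := by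
  rw [← X.res_one le_top, germ_res]; rfl

theorem germ_zero {U : Opens X.carrier} {x : X.carrier} (hx : x ∈ U) :
    germ hx (0 : X.Γ U) = 0 := by
  rw [← X.res_zero le_top, germ_res]; rfl

instance (x : X.carrier) : CommMonoidWithZero (X.stalk x) where
  mul_assoc a b c := by
    obtain ⟨U, hU, a, rfl⟩ := exists_germ a
    obtain ⟨V, hV, b, c, rfl, rfl⟩ := exists_germ₂ b c
    have hx : x ∈ U ⊓ V := ⟨hU, hV⟩
    rw [← germ_res inf_le_left hx a, ← germ_res inf_le_right hx b, ← germ_res inf_le_right hx c]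
    simp only [← germ_mul, mul_assoc]
  mul_comm a b := by
    obtain ⟨U, hU, a, b, rfl, rfl⟩ := exists_germ₂ a b
    rw [← germ_mul, ← germ_mul, mul_comm]
  one_mul a := by
    obtain ⟨U, hU, a, rfl⟩ := exists_germ a
    rw [← germ_one hU, ← germ_mul, one_mul]
  mul_one a := by
    obtain ⟨U, hU, a, rfl⟩ := exists_germ a
    rw [← germ_one hU, ← germ_mul, mul_one]
  zero_mul a := by
    obtain ⟨U, hU, a, rfl⟩ := exists_germ a
    rw [← germ_zero hU, ← germ_mul, zero_mul]
  mul_zero a := by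
    obtain ⟨U, hU, a, rfl⟩ := exists_germ a
    rw [← germ_zero hU, ← germ_mul, mul_zero]

/-- The monoided space whose structure sheaf consists of the families `x ↦ f x` of elements of the
pointed monoids `T x` which locally satisfy `P`. -/
def ofFibers {X : TopCat.{u}} {T : X → Type u} [∀ x, CommMonoidWithZero (T x)]
    (P : TopCat.PrelocalPredicate T)
    (h0 : P.pred (U := ⊤) (fun x => (0 : T x))) (h1 : P.pred (U := ⊤) (fun x => (1 : T x)))
    (hmul : ∀ (U : Opens X) (f g : ∀ x : U, T x), P.pred f → P.pred g →
      P.pred (fun x => f x * g x)) : MonoidedSpace.{u} where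
  carrier := X
  sheaf := fiberSheaf P
  monoid U :=
    let p0 : P.sheafify.pred (fun x : U => (0 : T x)) := fun x =>
      ⟨U, x.2, 𝟙 _, P.res (homOfLE le_top) _ h0⟩
    let p1 : P.sheafify.pred (fun x : U => (1 : T x)) := fun x =>
      ⟨U, x.2, 𝟙 _, P.res (homOfLE le_top) _ h1⟩
    { mul := fun f g => ⟨fun x => f.1 x * g.1 x,
        P.sheafify_inductionOn₂ P P (fun a b => a * b) (fun {V W} a b ha hb p =>
          ⟨V ⊓ W, homOfLE inf_le_left, homOfLE inf_le_right, p.2,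
            hmul _ _ _ (P.res (homOfLE inf_le_left) _ ha) (P.res (homOfLE inf_le_right) _ hb)⟩)
          f.2 g.2⟩
      one := ⟨fun x => 1, p1⟩
      zero := ⟨fun x => 0, p0⟩
      mul_assoc := fun f g h => Subtype.ext (funext fun x => mul_assoc _ _ _)
      mul_comm := fun f g => Subtype.ext (funext fun x => mul_comm _ _)
      one_mul := fun f => Subtype.ext (funext fun x => one_mul _)
      mul_one := fun f => Subtype.ext (funext fun x => mul_one _)
      zero_mul := fun f => Subtype.ext (funext fun x => zero_mul _)
      mul_zero := fun f => Subtype.ext (funext fun x => mul_zero _) }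
  res_zero _ := rfl
  res_one _ := rfl
  res_mul _ _ _ := rfl

end MonoidedSpace

/-! ### Sheaves of `𝒜`-sets -/

/-- A sheaf of `𝒜`-sets on the monoided space `(X, 𝒜)`: a sheaf of pointed sets `L` on which `𝒜`
acts, i.e. each `L(U)` is a pointed set with an action of the pointed monoid `𝒜(U)`, compatibly
with restriction. -/
structure ASet (X : MonoidedSpace.{u}) : Type (u + 1) where
  sheaf : TopCat.Sheaf (Type u) X.carrier
  [zero : ∀ U : Opens X.carrier, Zero (Sec sheaf U)]
  [action : ∀ U : Opens X.carrier, MulActionWithZero (X.Γ U) (Sec sheaf U)]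
  res_zero : ∀ {U V : Opens X.carrier} (h : U ≤ V), res h (0 : Sec sheaf V) = 0
  res_smul : ∀ {U V : Opens X.carrier} (h : U ≤ V) (a : X.Γ V) (s : Sec sheaf V),
    res h (a • s) = res h a • res h s

attribute [instance] ASet.zero ASet.action

namespace ASet

open MonoidedSpace

variable {X : MonoidedSpace.{u}}

/-- Sections of a sheaf of `𝒜`-sets. -/
abbrev Γ (L : ASet X) (U : Opens X.carrier) : Type u := Sec L.sheaf U

/-- Stalks of a sheaf of `𝒜`-sets. -/
abbrev stalk (L : ASet X) (x : X.carrier) : Type u := Stk L.sheaf x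

section Stalk

variable (L : ASet X) (x : X.carrier)

/-- The stalk of a sheaf of `𝒜`-sets at `x` is a set with an action of the stalk of `𝒜`. -/
instance : SMul (X.stalk x) (L.stalk x) := ⟨stalkMap₂ (fun _ a b => a • b) L.res_smul x⟩
instance : Zero (L.stalk x) := ⟨germ (U := ⊤) trivial (0 : L.Γ ⊤)⟩

variable {L x}

theorem germ_smul {U : Opens X.carrier} (hx : x ∈ U) (a : X.Γ U) (s : L.Γ U) :
    germ hx (a • s) = germ hx a • germ hx s :=
  (stalkMap₂_germ (fun _ a b => a • b) L.res_smul hx a s).symm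

theorem germ_zero {U : Opens X.carrier} (hx : x ∈ U) : germ hx (0 : L.Γ U) = 0 := by
  rw [← L.res_zero le_top, germ_res]; rfl

instance : MulActionWithZero (X.stalk x) (L.stalk x) where
  one_smul s := by
    obtain ⟨U, hU, s, rfl⟩ := exists_germ s
    rw [← MonoidedSpace.germ_one hU, ← germ_smul, one_smul]
  mul_smul a b s := by
    obtain ⟨U, hU, a, rfl⟩ := exists_germ a
    obtain ⟨V, hV, b, s, rfl, rfl⟩ := exists_germ₂ b s
    have hx : x ∈ U ⊓ V := ⟨hU, hV⟩
    rw [← germ_res inf_le_left hx a, ← germ_res inf_le_right hx b, ← germ_res inf_le_right hx s]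
    simp only [← germ_smul, ← MonoidedSpace.germ_mul, mul_smul]
  smul_zero a := by
    obtain ⟨U, hU, a, rfl⟩ := exists_germ a
    rw [← germ_zero hU, ← germ_smul, smul_zero]
  zero_smul s := by
    obtain ⟨U, hU, s, rfl⟩ := exists_germ s
    rw [← MonoidedSpace.germ_zero hU, ← germ_smul, zero_smul, germ_zero]

end Stalk

/-- The sheaf of `𝒜`-sets whose sections are the families `x ↦ f x` of elements of the
`𝒜_x`-sets `T x` which locally satisfy `P`. -/
def ofFibers {T : X.carrier → Type u} [∀ x, Zero (T x)]
    [∀ x, MulActionWithZero (X.stalk x) (T x)] (P : TopCat.PrelocalPredicate T)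
    (h0 : P.pred (U := ⊤) (fun x => (0 : T x)))
    (hsmul : ∀ (U : Opens X.carrier) (a : X.Γ U) (f : ∀ x : U, T x), P.pred f →
      P.pred (fun x => germ x.2 a • f x)) : ASet X where
  sheaf := fiberSheaf P
  zero U := ⟨⟨fun _ => 0, fun x => ⟨U, x.2, 𝟙 _, P.res (homOfLE le_top) _ h0⟩⟩⟩
  action U :=
    letI : Zero (Sec (fiberSheaf P) U) :=
      ⟨⟨fun _ => 0, fun x => ⟨U, x.2, 𝟙 _, P.res (homOfLE le_top) _ h0⟩⟩⟩
    { smul := fun a f => ⟨fun x => germ x.2 a • f.1 x, fun x => by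
        obtain ⟨V, hV, i, hf⟩ := f.2 x
        refine ⟨V, hV, i, ?_⟩
        simpa only [germ_res] using hsmul V (res i.le a) _ hf⟩
      one_smul := fun f => Subtype.ext (funext fun x =>
        (congrArg (· • f.1 x) (MonoidedSpace.germ_one x.2)).trans (one_smul _ _))
      mul_smul := fun a b f => Subtype.ext (funext fun x =>
        (congrArg (· • f.1 x) (MonoidedSpace.germ_mul x.2 a b)).trans (mul_smul _ _ _))
      smul_zero := fun a => Subtype.ext (funext fun x => smul_zero _)
      zero_smul := fun f => Subtype.ext (funext fun x =>
        (congrArg (· • f.1 x) (MonoidedSpace.germ_zero x.2)).trans (zero_smul _ _)) }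
  res_zero _ := rfl
  res_smul h a f := Subtype.ext (funext fun x =>
    congrArg (· • f.1 ⟨x.1, h x.2⟩) (germ_res h x.2 a).symm)

/-- The structure sheaf as a sheaf of `𝒜`-sets. -/
def unit (X : MonoidedSpace.{u}) : ASet X where
  sheaf := X.sheaf
  action U := inferInstanceAs (MulActionWithZero (X.Γ U) (X.Γ U))
  res_zero := X.res_zero
  res_smul := X.res_mul

/-- An isomorphism `L|_U ≅ M|_U` of sheaves of `𝒜|_U`-sets. (Equivariant maps preserve the
base points, since the base point is `0 • s` for every `s`.) -/
structure IsoOn (U : Opens X.carrier) (L M : ASet X) where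
  toEquiv : ∀ V ≤ U, L.Γ V ≃ M.Γ V
  map_smul : ∀ (V) (hV : V ≤ U) (a : X.Γ V) (s : L.Γ V),
    toEquiv V hV (a • s) = a • toEquiv V hV s
  map_res : ∀ {V W} (h : V ≤ W) (hW : W ≤ U) (s : L.Γ W),
    toEquiv V (h.trans hW) (res h s) = res h (toEquiv W hW s)

/-- Isomorphism of sheaves of `𝒜`-sets. -/
abbrev Iso (L M : ASet X) := IsoOn ⊤ L M

/-- `L` is invertible if it is locally isomorphic to `𝒜`. -/
def IsInvertible (L : ASet X) : Prop :=
  ∀ x : X.carrier, ∃ U : Opens X.carrier, x ∈ U ∧ Nonempty (IsoOn U L (unit X))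

namespace IsoOn

variable {U : Opens X.carrier} {L M N : ASet X}

def refl (U : Opens X.carrier) (L : ASet X) : IsoOn U L L where
  toEquiv _ _ := Equiv.refl _
  map_smul _ _ _ _ := rfl
  map_res _ _ _ := rfl

def symm (e : IsoOn U L M) : IsoOn U M L where
  toEquiv V hV := (e.toEquiv V hV).symm
  map_smul V hV a s := by rw [Equiv.symm_apply_eq, e.map_smul, Equiv.apply_symm_apply]
  map_res h hW s := by rw [Equiv.symm_apply_eq, e.map_res h hW, Equiv.apply_symm_apply]

def trans (e : IsoOn U L M) (f : IsoOn U M N) : IsoOn U L N where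
  toEquiv V hV := (e.toEquiv V hV).trans (f.toEquiv V hV)
  map_smul V hV a s := by simp [e.map_smul, f.map_smul]
  map_res h hW s := by simp only [Equiv.trans_apply]; rw [e.map_res h hW, f.map_res h hW]

def restrict {V : Opens X.carrier} (e : IsoOn U L M) (h : V ≤ U) : IsoOn V L M where
  toEquiv W hW := e.toEquiv W (hW.trans h)
  map_smul W hW := e.map_smul W (hW.trans h)
  map_res h' hW := e.map_res h' (hW.trans h)

theorem exists_stalkMap (e : IsoOn U L M) (x : X.carrier) :
    ∃ φ : L.stalk x → M.stalk x, ∀ (V : Opens X.carrier) (hV : V ≤ U) (hx : x ∈ V) (s : L.Γ V),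
      φ (germ hx s) = germ hx (e.toEquiv V hV s) := by
  by_cases hU : x ∈ U
  · choose V hV s hs using fun t : L.stalk x => exists_germ t
    have hVU : ∀ t, x ∈ V t ⊓ U := fun t => ⟨hV t, hU⟩
    refine ⟨fun t => germ (hVU t)
      (e.toEquiv _ inf_le_right (res inf_le_left (s t))), fun W hW hx a => ?_⟩
    obtain ⟨W', hW', i, j, h⟩ := germ_eq (hs (germ hx a))
    dsimp only
    rw [← germ_res (le_inf i (j.trans hW)) hW', ← e.map_res, res_res, h, e.map_res j hW, germ_res]
  · exact ⟨fun _ => 0, fun V hV hx => (hU (hV hx)).elim⟩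

/-- The map on stalks induced by an isomorphism over `U` (of interest for `x ∈ U`). -/
def stalkMap (e : IsoOn U L M) (x : X.carrier) : L.stalk x → M.stalk x :=
  (e.exists_stalkMap x).choose

theorem stalkMap_germ (e : IsoOn U L M) {x : X.carrier} {V : Opens X.carrier} (hV : V ≤ U)
    (hx : x ∈ V) (s : L.Γ V) : e.stalkMap x (germ hx s) = germ hx (e.toEquiv V hV s) :=
  (e.exists_stalkMap x).choose_spec V hV hx s

theorem exists_germ_le {F : TopCat.Sheaf (Type u) X.carrier} {x : X.carrier} (hU : x ∈ U)
    (t : Stk F x) : ∃ (V : Opens X.carrier) (_ : V ≤ U) (hx : x ∈ V) (s : Sec F V),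
      germ hx s = t := by
  obtain ⟨V, hV, s, rfl⟩ := exists_germ t
  exact ⟨V ⊓ U, inf_le_right, ⟨hV, hU⟩, res inf_le_left s, germ_res _ _ _⟩

theorem stalkMap_smul (e : IsoOn U L M) {x : X.carrier} (hU : x ∈ U) (a : X.stalk x)
    (s : L.stalk x) : e.stalkMap x (a • s) = a • e.stalkMap x s := by
  obtain ⟨V, hV, hx, s, rfl⟩ := exists_germ_le hU s
  obtain ⟨W, hW, hx', a, rfl⟩ := exists_germ_le hx a
  rw [← germ_res hW hx', ← germ_smul, e.stalkMap_germ (hW.trans hV),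
    e.stalkMap_germ (hW.trans hV), e.map_smul, germ_smul]

theorem symm_stalkMap (e : IsoOn U L M) {x : X.carrier} (hU : x ∈ U) (s : L.stalk x) :
    e.symm.stalkMap x (e.stalkMap x s) = s := by
  obtain ⟨V, hV, hx, s, rfl⟩ := exists_germ_le hU s
  rw [e.stalkMap_germ hV, e.symm.stalkMap_germ hV]
  exact congrArg _ ((e.toEquiv V hV).symm_apply_apply s)

theorem stalkMap_bijective (e : IsoOn U L M) {x : X.carrier} (hU : x ∈ U) :
    Function.Bijective (e.stalkMap x) :=
  ⟨Function.LeftInverse.injective (e.symm_stalkMap hU),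
    Function.RightInverse.surjective (e.symm.symm_stalkMap hU)⟩

/-- An isomorphism over `U` can be given by bijective equivariant maps on the stalks at the points
of `U` which locally take sections to sections. -/
theorem nonempty_of_stalks (φ : ∀ x, L.stalk x → M.stalk x)
    (hbij : ∀ x ∈ U, Function.Bijective (φ x))
    (hsmul : ∀ x ∈ U, ∀ (a : X.stalk x) (s : L.stalk x), φ x (a • s) = a • φ x s)
    (hsec : ∀ V ≤ U, ∀ (s : L.Γ V), ∀ x ∈ V, ∃ (W : Opens X.carrier) (hW : W ≤ V) (_ : x ∈ W)
      (t : M.Γ W), ∀ (y) (hy : y ∈ W), φ y (germ (hW hy) s) = germ hy t) :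
    Nonempty (IsoOn U L M) := by
  have key : ∀ V ≤ U, ∀ s : L.Γ V, ∃ t : M.Γ V, ∀ (y) (hy : y ∈ V),
      φ y (germ hy s) = germ hy t := by
    intro V hV s
    choose W hW hx t ht using fun x : V => hsec V hV s x.1 x.2
    obtain ⟨t', ht'⟩ := glue W hW (fun x hx' => ⟨⟨x, hx'⟩, hx _⟩) t
      (fun i j x hi hj => by rw [← ht, ← ht])
    refine ⟨t', fun y hy => ?_⟩
    rw [← germ_res (hW ⟨y, hy⟩) (hx ⟨y, hy⟩) t', ht', ← ht]
  choose f hf using key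
  have hb : ∀ V hV, Function.Bijective (f V hV) := by
    refine fun V hV => ⟨fun s s' h => sec_ext fun x hx => (hbij x (hV hx)).1 ?_, fun t => ?_⟩
    · rw [hf V hV, hf V hV, h]
    · have : ∀ x : V, ∃ (W : Opens X.carrier) (_ : W ≤ V) (_ : x.1 ∈ W) (s : L.Γ W),
          ∀ y (hy : y ∈ W) (hy' : y ∈ V), φ y (germ hy s) = germ hy' t := by
        intro x
        obtain ⟨r, hr⟩ := (hbij x.1 (hV x.2)).2 (germ x.2 t)
        obtain ⟨W, hW, hx, s, rfl⟩ := exists_germ_le x.2 r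
        rw [hf W (hW.trans hV)] at hr
        obtain ⟨W', hx', i, j, h⟩ := germ_eq hr
        refine ⟨W', j, hx', res i s, fun y hy hy' => ?_⟩
        rw [germ_res, hf W (hW.trans hV), ← germ_res i hy, h, germ_res]
      choose W hW hx s hs using this
      obtain ⟨s', hs'⟩ := glue W hW (fun x hx' => ⟨⟨x, hx'⟩, hx _⟩) s
        (fun i j x hi hj => (hbij x (hV (hW i hi))).1 (by
          rw [hs i x hi (hW i hi), hs j x hj (hW i hi)]))
      refine ⟨s', sec_ext fun y hy => ?_⟩
      rw [← hf, ← germ_res (hW ⟨y, hy⟩) (hx ⟨y, hy⟩) s', hs', hs _ _ _ hy]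
  exact ⟨{
    toEquiv := fun V hV => Equiv.ofBijective (f V hV) (hb V hV)
    map_smul := fun V hV a s => sec_ext fun x hx => by
      simp only [Equiv.ofBijective_apply]
      rw [germ_smul, ← hf, ← hf, germ_smul, hsmul x (hV hx)]
    map_res := fun {V W} h hW s => sec_ext fun x hx => by
      simp only [Equiv.ofBijective_apply]
      rw [germ_res, ← hf, ← hf, germ_res] }⟩

end IsoOn

end ASet

/-! ### Smash products over a pointed monoid -/

section Smash

variable {A : Type u} [CommMonoidWithZero A]

/-- The relation `(a m, n) ∼ (m, a n)` on `M × N`. As `(m, 0) = (m, 0 • 0) ∼ (0 • m, 0) = (0, 0)`,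
and similarly for `(0, n)`, it also collapses `M × {0} ∪ {0} × N` to a point. -/
inductive SmashOver.Rel (A M N : Type u) [CommMonoidWithZero A] [Zero M] [Zero N]
    [MulActionWithZero A M] [MulActionWithZero A N] : M × N → M × N → Prop
  | smul (a : A) (m : M) (n : N) : SmashOver.Rel A M N (a • m, n) (m, a • n)

/-- The smash product `M ∧_A N` of two `A`-sets. -/
def SmashOver (A M N : Type u) [CommMonoidWithZero A] [Zero M] [Zero N]
    [MulActionWithZero A M] [MulActionWithZero A N] : Type u :=
  Quot (SmashOver.Rel A M N)

namespace SmashOver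

variable {M N : Type u} [Zero M] [Zero N] [MulActionWithZero A M] [MulActionWithZero A N]

/-- The class `m ∧ n`. -/
def mk (m : M) (n : N) : SmashOver A M N := Quot.mk _ (m, n)

theorem mk_smul (a : A) (m : M) (n : N) : (mk (a • m) n : SmashOver A M N) = mk m (a • n) :=
  Quot.sound (Rel.smul a m n)

theorem ind {p : SmashOver A M N → Prop} (h : ∀ m n, p (mk m n)) (t : SmashOver A M N) : p t :=
  Quot.ind (fun x => h x.1 x.2) t

/-- Maps out of `M ∧_A N` are balanced maps out of `M × N`. -/
def lift {P : Type u} (f : M → N → P) (hf : ∀ (a : A) m n, f (a • m) n = f m (a • n)) :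
    SmashOver A M N → P :=
  Quot.lift (fun x => f x.1 x.2) (by rintro _ _ ⟨a, m, n⟩; exact hf a m n)

theorem lift_mk {P : Type u} (f : M → N → P) (hf : ∀ (a : A) m n, f (a • m) n = f m (a • n))
    (m : M) (n : N) : lift f hf (mk m n) = f m n := rfl

instance : Zero (SmashOver A M N) := ⟨mk 0 0⟩

instance : SMul A (SmashOver A M N) :=
  ⟨fun a => lift (fun m n => mk (a • m) n) fun b m n => by
    rw [← mul_smul, mul_comm, mul_smul, mk_smul]⟩

theorem smul_mk (a : A) (m : M) (n : N) : a • (mk m n : SmashOver A M N) = mk (a • m) n := rfl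

instance : MulActionWithZero A (SmashOver A M N) where
  one_smul := ind fun m n => by rw [smul_mk, one_smul]
  mul_smul a b := ind fun m n => by rw [smul_mk, smul_mk, smul_mk, mul_smul]
  smul_zero a := by change mk (a • 0) 0 = mk 0 0; rw [smul_zero]
  zero_smul := ind fun m n => by
    change mk ((0 : A) • m) n = mk 0 0
    rw [zero_smul, ← smul_zero (0 : A), mk_smul, zero_smul, smul_zero]

end SmashOver

variable {B : Type u} [CommMonoidWithZero B]

/-- The relation `(b φ(a), m) ∼ (b, a m)` on `B × M`. -/
inductive BaseChange.Rel (φ : A →*₀ B) (M : Type u) [Zero M] [MulActionWithZero A M] :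
    B × M → B × M → Prop
  | smul (a : A) (b : B) (m : M) : BaseChange.Rel φ M (b * φ a, m) (b, a • m)

/-- The extension of scalars `B ∧_A M` of the `A`-set `M` along `φ : A → B`. -/
def BaseChange (φ : A →*₀ B) (M : Type u) [Zero M] [MulActionWithZero A M] : Type u :=
  Quot (BaseChange.Rel φ M)

namespace BaseChange

variable {φ : A →*₀ B} {M : Type u} [Zero M] [MulActionWithZero A M]

variable (φ) in
/-- The class `b ∧ m`. -/
def mk (b : B) (m : M) : BaseChange φ M := Quot.mk _ (b, m)

theorem mk_mul (a : A) (b : B) (m : M) : mk φ (b * φ a) m = mk φ b (a • m) :=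
  Quot.sound (Rel.smul a b m)

theorem ind {p : BaseChange φ M → Prop} (h : ∀ b m, p (mk φ b m)) (t : BaseChange φ M) : p t :=
  Quot.ind (fun x => h x.1 x.2) t

/-- Maps out of `B ∧_A M` are balanced maps out of `B × M`. -/
def lift {P : Type u} (f : B → M → P) (hf : ∀ (a : A) b m, f (b * φ a) m = f b (a • m)) :
    BaseChange φ M → P :=
  Quot.lift (fun x => f x.1 x.2) (by rintro _ _ ⟨a, b, m⟩; exact hf a b m)

theorem lift_mk {P : Type u} (f : B → M → P) (hf : ∀ (a : A) b m, f (b * φ a) m = f b (a • m))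
    (b : B) (m : M) : lift f hf (mk φ b m) = f b m := rfl

instance : Zero (BaseChange φ M) := ⟨mk φ 0 0⟩

instance : SMul B (BaseChange φ M) :=
  ⟨fun c => lift (fun b m => mk φ (c * b) m) fun a b m => by rw [← mul_assoc, mk_mul]⟩

theorem smul_mk (c b : B) (m : M) : c • mk φ b m = mk φ (c * b) m := rfl

instance : MulActionWithZero B (BaseChange φ M) where
  one_smul := ind fun b m => by rw [smul_mk, one_mul]
  mul_smul c d := ind fun b m => by rw [smul_mk, smul_mk, smul_mk, mul_assoc]
  smul_zero c := by change mk φ (c * 0) 0 = mk φ 0 0; rw [mul_zero]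
  zero_smul := ind fun b m => by
    change mk φ (0 * b) m = mk φ 0 0
    have h := mk_mul (φ := φ) 0 0 m
    rw [zero_smul, map_zero, zero_mul] at h
    rw [zero_mul, h]

end BaseChange

end Smash

namespace ASet

open MonoidedSpace

variable {X : MonoidedSpace.{u}}

/-! ### The smash product of sheaves of `𝒜`-sets -/

/-- The families `x ↦ l_x ∧ m_x` given by sections `l`, `m`. -/
def smashPre (L M : ASet X) :
    TopCat.PrelocalPredicate fun x => SmashOver (X.stalk x) (L.stalk x) (M.stalk x) where
  pred {U} f := ∃ (l : L.Γ U) (m : M.Γ U), ∀ x : U, f x = .mk (germ x.2 l) (germ x.2 m)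
  res := by
    rintro U V i f ⟨l, m, h⟩
    exact ⟨res i.le l, res i.le m, fun x => by rw [germ_res, germ_res]; exact h _⟩

/-- The smash product `L ∧_𝒜 M`, i.e. the sheaf associated to `U ↦ L(U) ∧_{𝒜(U)} M(U)`: its
sections are the families of elements of the smash products `L_x ∧_{𝒜_x} M_x` of the stalks
which locally are of the form `x ↦ l_x ∧ m_x` for sections `l`, `m`. -/
def smash (L M : ASet X) : ASet X :=
  ofFibers (smashPre L M)
    ⟨0, 0, fun x => by rw [germ_zero, germ_zero]; rfl⟩
    (by
      rintro U a f ⟨l, m, h⟩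
      exact ⟨a • l, m, fun x => by
        change germ x.2 a • f x = _
        rw [germ_smul, h x, SmashOver.smul_mk]⟩)

section OfFibers

variable {T : X.carrier → Type u} [∀ x, Zero (T x)] [∀ x, MulActionWithZero (X.stalk x) (T x)]
  {P : TopCat.PrelocalPredicate T} {h0 : P.pred (U := ⊤) (fun x => (0 : T x))}
  {hsmul : ∀ (U : Opens X.carrier) (a : X.Γ U) (f : ∀ x : U, T x), P.pred f →
      P.pred (fun x => germ x.2 a • f x)}

theorem value_smul {x : X.carrier} (a : X.stalk x) (s : (ofFibers P h0 hsmul).stalk x) :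
    value (P := P) x (a • s) = a • value (P := P) x s := by
  obtain ⟨U, hU, a, s, rfl, rfl⟩ := exists_germ₂ a s
  rw [← germ_smul]
  exact (value_germ hU _).trans (congrArg _ (value_germ hU s).symm)

end OfFibers

section SmashLemmas

variable (L M : ASet X)

/-- The section `l ∧ m` of `L ∧ M`. -/
def pure {L M : ASet X} {U : Opens X.carrier} (l : L.Γ U) (m : M.Γ U) : (smash L M).Γ U :=
  ⟨fun x => .mk (germ x.2 l) (germ x.2 m),
    TopCat.PrelocalPredicate.sheafifyOf ⟨l, m, fun _ => rfl⟩⟩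

/-- The canonical map `(L ∧ M)_x → L_x ∧ M_x`. -/
def smashValue (x : X.carrier) :
    (smash L M).stalk x → SmashOver (X.stalk x) (L.stalk x) (M.stalk x) :=
  value (P := smashPre L M) x

variable {L M}

theorem smashValue_smul {x : X.carrier} (a : X.stalk x) (s : (smash L M).stalk x) :
    smashValue L M x (a • s) = a • smashValue L M x s := value_smul a s

theorem smashValue_pure {U : Opens X.carrier} {x : X.carrier} (hx : x ∈ U) (l : L.Γ U)
    (m : M.Γ U) : smashValue L M x (germ hx (pure l m)) = .mk (germ hx l) (germ hx m) :=
  value_germ hx _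

theorem res_pure {U V : Opens X.carrier} (h : U ≤ V) (l : L.Γ V) (m : M.Γ V) :
    res h (pure l m) = pure (res h l) (res h m) :=
  Subtype.ext (funext fun x => (congrArg₂ SmashOver.mk (germ_res h x.2 l) (germ_res h x.2 m)).symm)

theorem pure_smul {U : Opens X.carrier} (a : X.Γ U) (l : L.Γ U) (m : M.Γ U) :
    pure (a • l) m = pure l (a • m) :=
  Subtype.ext (funext fun x => by
    change SmashOver.mk _ _ = SmashOver.mk _ _
    rw [germ_smul, germ_smul, SmashOver.mk_smul])

theorem exists_pure {U : Opens X.carrier} (s : (smash L M).Γ U) {x : X.carrier} (hx : x ∈ U) :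
    ∃ (V : Opens X.carrier) (h : V ≤ U) (_ : x ∈ V) (l : L.Γ V) (m : M.Γ V),
      res h s = pure l m := by
  obtain ⟨V, hV, i, l, m, h⟩ := s.2 ⟨x, hx⟩
  exact ⟨V, i.le, hV, l, m, Subtype.ext (funext h)⟩

theorem smashValue_bijective (x : X.carrier) : Function.Bijective (smashValue L M x) := by
  have hb : ∀ {U V : Opens X.carrier} (h : U ≤ V) (l : L.Γ V) (m : M.Γ V),
      res h (pure l m) = pure (res h l) (res h m) := res_pure
  let g : SmashOver (X.stalk x) (L.stalk x) (M.stalk x) → (smash L M).stalk x :=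
    SmashOver.lift (stalkMap₂ (fun _ l m => pure l m) hb x) (by
      intro a l m
      obtain ⟨U, hU, a, rfl⟩ := exists_germ a
      obtain ⟨V, hV, l, m, rfl, rfl⟩ := exists_germ₂ l m
      have hx : x ∈ U ⊓ V := ⟨hU, hV⟩
      rw [← germ_res inf_le_left hx a, ← germ_res inf_le_right hx l, ← germ_res inf_le_right hx m,
        ← germ_smul, ← germ_smul, stalkMap₂_germ, stalkMap₂_germ, pure_smul])
  have hg : ∀ {U : Opens X.carrier} (hx : x ∈ U) (l : L.Γ U) (m : M.Γ U),
      g (.mk (germ hx l) (germ hx m)) = germ hx (pure l m) := fun hx l m =>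
    stalkMap₂_germ (fun _ l m => pure l m) hb hx l m
  refine ⟨Function.LeftInverse.injective (g := g) fun s => ?_, ?_⟩
  · obtain ⟨U, hU, s, rfl⟩ := exists_germ s
    obtain ⟨V, h, hV, l, m, e⟩ := exists_pure s hU
    rw [← germ_res h hV, e, smashValue_pure, hg]
  · refine SmashOver.ind fun l m => ?_
    obtain ⟨U, hU, l, m, rfl, rfl⟩ := exists_germ₂ l m
    exact ⟨_, smashValue_pure hU l m⟩

/-- To give an isomorphism `L ∧ M ≅ N` over `U`, it suffices to give equivariant bijections
`L_x ∧ M_x → N_x` for `x ∈ U` which locally take the germs `l_x ∧ m_x` to germs of sections. -/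
theorem nonempty_smash_iso {N : ASet X} {U : Opens X.carrier}
    (φ : ∀ x, SmashOver (X.stalk x) (L.stalk x) (M.stalk x) → N.stalk x)
    (hbij : ∀ x ∈ U, Function.Bijective (φ x))
    (hsmul : ∀ x ∈ U, ∀ (a : X.stalk x) l m, φ x (.mk (a • l) m) = a • φ x (.mk l m))
    (hsec : ∀ V ≤ U, ∀ (l : L.Γ V) (m : M.Γ V), ∀ x ∈ V, ∃ (W : Opens X.carrier) (hW : W ≤ V)
      (_ : x ∈ W) (t : N.Γ W), ∀ (y) (hy : y ∈ W),
        φ y (.mk (germ (hW hy) l) (germ (hW hy) m)) = germ hy t) :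
    Nonempty (IsoOn U (smash L M) N) := by
  refine IsoOn.nonempty_of_stalks (fun x s => φ x (smashValue L M x s))
    (fun x hx => (hbij x hx).comp (smashValue_bijective x)) (fun x hx a s => ?_)
    (fun V hV s x hx => ?_)
  · rw [smashValue_smul]
    obtain ⟨⟨l, m⟩, h⟩ := Quot.exists_rep (smashValue L M x s)
    rw [← h]
    exact hsmul x hx a l m
  · obtain ⟨V', h, hx', l, m, e⟩ := exists_pure s hx
    obtain ⟨W, hW, hxW, t, ht⟩ := hsec V' (h.trans hV) l m x hx'
    refine ⟨W, hW.trans h, hxW, t, fun y hy => ?_⟩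
    rw [← ht y hy, ← germ_res h (hW hy), e, smashValue_pure]

theorem nonempty_smash_congr {L' M' : ASet X} {U : Opens X.carrier} (e : IsoOn U L L')
    (f : IsoOn U M M') : Nonempty (IsoOn U (smash L M) (smash L' M')) := by
  classical
  have hbal : ∀ x, x ∈ U → ∀ (a : X.stalk x) l m,
      (SmashOver.mk (e.stalkMap x (a • l)) (f.stalkMap x m) :
        SmashOver (X.stalk x) (L'.stalk x) (M'.stalk x)) =
      .mk (e.stalkMap x l) (f.stalkMap x (a • m)) := by
    intro x hx a l m
    rw [e.stalkMap_smul hx, f.stalkMap_smul hx, SmashOver.mk_smul]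
  have hbal' : ∀ x, x ∈ U → ∀ (a : X.stalk x) l m,
      (SmashOver.mk (e.symm.stalkMap x (a • l)) (f.symm.stalkMap x m) :
        SmashOver (X.stalk x) (L.stalk x) (M.stalk x)) =
      .mk (e.symm.stalkMap x l) (f.symm.stalkMap x (a • m)) := by
    intro x hx a l m
    rw [e.symm.stalkMap_smul hx, f.symm.stalkMap_smul hx, SmashOver.mk_smul]
  let ψ : ∀ x, SmashOver (X.stalk x) (L.stalk x) (M.stalk x) → (smash L' M').stalk x := fun x =>
    if hx : x ∈ U then fun s => (Equiv.ofBijective _ (smashValue_bijective x)).symm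
      (SmashOver.lift (fun l m => .mk (e.stalkMap x l) (f.stalkMap x m)) (hbal x hx) s)
    else fun _ => 0
  have hψ : ∀ x, x ∈ U → ∀ l m, smashValue L' M' x (ψ x (.mk l m)) =
      .mk (e.stalkMap x l) (f.stalkMap x m) := by
    intro x hx l m
    simp only [ψ, dif_pos hx]
    exact Equiv.apply_symm_apply (Equiv.ofBijective _ (smashValue_bijective x)) _
  refine nonempty_smash_iso ψ (fun x hx => ?_) (fun x hx a l m => ?_) (fun V hV l m x hx => ?_)
  · have hc : Function.Bijective (smashValue L' M' x ∘ ψ x) := by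
      let g := SmashOver.lift (fun l m => (SmashOver.mk (e.symm.stalkMap x l)
        (f.symm.stalkMap x m) : SmashOver (X.stalk x) (L.stalk x) (M.stalk x))) (hbal' x hx)
      refine ⟨Function.LeftInverse.injective (g := g) (SmashOver.ind fun l m => ?_),
        Function.RightInverse.surjective (g := g) (SmashOver.ind fun l m => ?_)⟩
      · rw [Function.comp_apply, hψ x hx]
        change SmashOver.mk _ _ = _
        rw [e.symm_stalkMap hx, f.symm_stalkMap hx]
      · change smashValue L' M' x (ψ x (SmashOver.mk _ _)) = _
        rw [hψ x hx]
        rw [show e.stalkMap x (e.symm.stalkMap x l) = l from e.symm.symm_stalkMap hx l,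
          show f.stalkMap x (f.symm.stalkMap x m) = m from f.symm.symm_stalkMap hx m]
    exact (Function.Bijective.of_comp_iff' (smashValue_bijective x) _).1 hc
  · apply (smashValue_bijective x).1
    rw [hψ x hx, smashValue_smul, hψ x hx, e.stalkMap_smul hx, SmashOver.smul_mk]
  · refine ⟨V, le_rfl, hx, pure (e.toEquiv V hV l) (f.toEquiv V hV m), fun y hy => ?_⟩
    apply (smashValue_bijective y).1
    rw [hψ y (hV hy), smashValue_pure, e.stalkMap_germ hV, f.stalkMap_germ hV]

theorem nonempty_smash_comm (L M : ASet X) : Nonempty (Iso (smash L M) (smash M L)) := by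
  let ψ : ∀ x, SmashOver (X.stalk x) (L.stalk x) (M.stalk x) → (smash M L).stalk x := fun x s =>
    (Equiv.ofBijective _ (smashValue_bijective x)).symm
      (SmashOver.lift (fun l m => .mk m l) (fun a l m => (SmashOver.mk_smul a m l).symm) s)
  have hψ : ∀ x l m, smashValue M L x (ψ x (.mk l m)) = .mk m l := fun x l m =>
    Equiv.apply_symm_apply (Equiv.ofBijective _ (smashValue_bijective x)) _
  refine nonempty_smash_iso ψ (fun x _ => ?_) (fun x _ a l m => ?_) (fun V hV l m x hx => ?_)
  · have hc : Function.Bijective (smashValue M L x ∘ ψ x) := by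
      let g : SmashOver (X.stalk x) (M.stalk x) (L.stalk x) → _ :=
        SmashOver.lift (fun m l => (SmashOver.mk l m :
          SmashOver (X.stalk x) (L.stalk x) (M.stalk x)))
          (fun a m l => (SmashOver.mk_smul a l m).symm)
      refine ⟨Function.LeftInverse.injective (g := g) (SmashOver.ind fun l m => ?_),
        Function.RightInverse.surjective (g := g) (SmashOver.ind fun l m => ?_)⟩
      · rw [Function.comp_apply, hψ]; rfl
      · exact hψ x m l
    exact (Function.Bijective.of_comp_iff' (smashValue_bijective x) _).1 hc
  · apply (smashValue_bijective x).1
    rw [hψ, smashValue_smul, hψ, SmashOver.smul_mk, SmashOver.mk_smul]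
  · refine ⟨V, le_rfl, hx, pure m l, fun y hy => ?_⟩
    apply (smashValue_bijective y).1
    rw [hψ, smashValue_pure]

theorem nonempty_unit_smash (L : ASet X) : Nonempty (Iso (smash (unit X) L) L) := by
  refine nonempty_smash_iso
    (fun x => SmashOver.lift (fun (a : X.stalk x) l => a • l)
      (fun a b l => by
        change X.stalk x at b
        exact (congrArg (· • l) (mul_comm a b)).trans (mul_smul b a l)))
    (fun x _ => ⟨?_, fun l => ⟨.mk (1 : X.stalk x) l, one_smul _ _⟩⟩)
    (fun x _ a (b : X.stalk x) l => mul_smul a b l)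
    (fun V hV a l x hx => ⟨V, le_rfl, hx, (show X.Γ V from a) • l, fun y hy => ?_⟩)
  · exact Function.LeftInverse.injective
      (g := fun l => (.mk (1 : X.stalk x) l : SmashOver (X.stalk x) ((unit X).stalk x) _))
      (SmashOver.ind fun (a : X.stalk x) l =>
        (SmashOver.mk_smul (M := (unit X).stalk x) a (1 : X.stalk x) l).symm.trans
          (congrArg (fun b : (unit X).stalk x => SmashOver.mk b l) (mul_one a)))
  · exact (germ_smul hy (show X.Γ V from a) l).symm

theorem nonempty_smash_assoc (L M N : ASet X) :
    Nonempty (Iso (smash (smash L M) N) (smash L (smash M N))) := by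
  -- the bijections of stalks
  let v : ∀ (L M : ASet X) x, (smash L M).stalk x ≃
      SmashOver (X.stalk x) (L.stalk x) (M.stalk x) := fun L M x =>
    Equiv.ofBijective _ (smashValue_bijective x)
  have vsm : ∀ (L M : ASet X) x (a : X.stalk x) t, (v L M x).symm (a • t) =
      a • (v L M x).symm t := fun L M x a t => by
    rw [Equiv.symm_apply_eq]
    refine Eq.trans ?_ (smashValue_smul a _).symm
    exact congrArg _ ((v L M x).apply_symm_apply t).symm
  have vp : ∀ (L M : ASet X) x {U : Opens X.carrier} (hx : x ∈ U) (l : L.Γ U) (m : M.Γ U),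
      (v L M x).symm (.mk (germ hx l) (germ hx m)) = germ hx (pure l m) := fun L M x U hx l m => by
    rw [Equiv.symm_apply_eq]; exact (smashValue_pure hx l m).symm
  let α : ∀ x, SmashOver (X.stalk x) (L.stalk x) (M.stalk x) → N.stalk x →
      (smash L (smash M N)).stalk x := fun x s n =>
    SmashOver.lift (fun l m => (v _ _ x).symm (.mk l ((v _ _ x).symm (.mk m n))))
      (fun a l m => by rw [SmashOver.mk_smul, ← vsm, SmashOver.smul_mk]) s
  have hα : ∀ x l m n, α x (.mk l m) n = (v _ _ x).symm (.mk l ((v _ _ x).symm (.mk m n))) :=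
    fun x l m n => rfl
  have hαb : ∀ x a s n, α x (a • s) n = α x s (a • n) := fun x a s n => by
    induction s using SmashOver.ind with | _ l m
    rw [SmashOver.smul_mk, hα, hα, ← SmashOver.mk_smul a m n, ← SmashOver.smul_mk a m n, vsm,
      SmashOver.mk_smul]
  let β : ∀ x, L.stalk x → SmashOver (X.stalk x) (M.stalk x) (N.stalk x) →
      (smash (smash L M) N).stalk x := fun x l s =>
    SmashOver.lift (fun m n => (v _ _ x).symm (.mk ((v _ _ x).symm (.mk l m)) n))
      (fun a m n => by
        rw [← SmashOver.mk_smul a l m, ← SmashOver.smul_mk a l m, vsm, SmashOver.mk_smul]) s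
  have hβ : ∀ x l m n, β x l (.mk m n) = (v _ _ x).symm (.mk ((v _ _ x).symm (.mk l m)) n) :=
    fun x l m n => rfl
  have hβb : ∀ x a l s, β x (a • l) s = β x l (a • s) := fun x a l s => by
    induction s using SmashOver.ind with | _ m n
    rw [SmashOver.smul_mk, hβ, hβ, SmashOver.mk_smul a l m]
  let φ : ∀ x, SmashOver (X.stalk x) ((smash L M).stalk x) (N.stalk x) →
      (smash L (smash M N)).stalk x := fun x =>
    SmashOver.lift (fun s n => α x (v _ _ x s) n) (fun a s n => by
      rw [← hαb]; exact congrArg (α x · n) (smashValue_smul a s))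
  let ψ : ∀ x, (smash L (smash M N)).stalk x →
      SmashOver (X.stalk x) ((smash L M).stalk x) (N.stalk x) := fun x s =>
    v _ _ x (SmashOver.lift (fun l s => β x l (v _ _ x s)) (fun a l s => by
      rw [hβb]; exact congrArg (β x l) (smashValue_smul a s).symm) (v _ _ x s))
  have hφ : ∀ x l m n, φ x (.mk ((v _ _ x).symm (.mk l m)) n) =
      (v _ _ x).symm (.mk l ((v _ _ x).symm (.mk m n))) := fun x l m n => by
    change α x (v _ _ x ((v _ _ x).symm _)) n = _
    rw [Equiv.apply_symm_apply]
    exact hα x l m n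
  have hψ : ∀ x l m n, ψ x ((v _ _ x).symm (.mk l ((v _ _ x).symm (.mk m n)))) =
      .mk ((v _ _ x).symm (.mk l m)) n := fun x l m n => by
    simp only [ψ, Equiv.apply_symm_apply, SmashOver.lift_mk, hβ]
  refine nonempty_smash_iso φ (fun x _ => ⟨Function.LeftInverse.injective (g := ψ x) ?_,
    Function.RightInverse.surjective (g := ψ x) ?_⟩) (fun x _ a s n => ?_) (fun V hV s n x hx => ?_)
  · refine SmashOver.ind fun s n => ?_
    obtain ⟨t, rfl⟩ := (v _ _ x).symm.surjective s
    induction t using SmashOver.ind with | _ l m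
    rw [hφ, hψ]
  · intro s
    obtain ⟨t, rfl⟩ := (v _ _ x).symm.surjective s
    induction t using SmashOver.ind with | _ l s
    obtain ⟨t, rfl⟩ := (v _ _ x).symm.surjective s
    induction t using SmashOver.ind with | _ m n
    rw [hψ, hφ]
  · obtain ⟨t, rfl⟩ := (v _ _ x).symm.surjective s
    induction t using SmashOver.ind with | _ l m
    rw [← vsm, SmashOver.smul_mk, hφ, hφ, ← vsm, SmashOver.smul_mk]
  · obtain ⟨W, h, hxW, l, m, e⟩ := exists_pure s hx
    refine ⟨W, h, hxW, pure l (pure m (res h n)), fun y hy => ?_⟩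
    rw [← germ_res h hy s, ← germ_res h hy n, e, ← vp, hφ, vp, vp]

theorem IsInvertible.smash {L M : ASet X} (hL : L.IsInvertible) (hM : M.IsInvertible) :
    (smash L M).IsInvertible := by
  intro x
  obtain ⟨U, hU, ⟨e⟩⟩ := hL x
  obtain ⟨V, hV, ⟨f⟩⟩ := hM x
  obtain ⟨g⟩ := nonempty_smash_congr (e.restrict (inf_le_left : U ⊓ V ≤ U))
    (f.restrict (inf_le_right : U ⊓ V ≤ V))
  obtain ⟨h⟩ := nonempty_unit_smash (unit X)
  exact ⟨U ⊓ V, ⟨hU, hV⟩, ⟨g.trans (h.restrict le_top)⟩⟩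

theorem isInvertible_unit (X : MonoidedSpace.{u}) : (unit X).IsInvertible :=
  fun _ => ⟨⊤, trivial, ⟨IsoOn.refl _ _⟩⟩

end SmashLemmas

/-! ### The dual of a sheaf of `𝒜`-sets -/

/-- The `A`-set of equivariant maps `M → A`. -/
@[ext]
structure Dual (A M : Type u) [CommMonoidWithZero A] [Zero M] [MulActionWithZero A M] : Type u where
  toFun : M → A
  map_smul : ∀ (a : A) (m : M), toFun (a • m) = a * toFun m

namespace Dual

variable {A M : Type u} [CommMonoidWithZero A] [Zero M] [MulActionWithZero A M]

instance : Zero (Dual A M) := ⟨⟨fun _ => 0, fun _ _ => (mul_zero _).symm⟩⟩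

instance : MulActionWithZero A (Dual A M) where
  smul a f := ⟨fun m => a * f.1 m, fun b m => by rw [f.2, mul_left_comm]⟩
  one_smul f := Dual.ext (funext fun _ => one_mul _)
  mul_smul a b f := Dual.ext (funext fun _ => mul_assoc _ _ _)
  smul_zero a := Dual.ext (funext fun _ => mul_zero _)
  zero_smul f := Dual.ext (funext fun _ => zero_mul _)

theorem smul_val (a : A) (f : Dual A M) (m : M) : (a • f).1 m = a * f.1 m := rfl

end Dual

/-- The families of equivariant maps of stalks `L_x → 𝒜_x` which take sections of `L` to sections
of `𝒜`. -/
def dualPre (L : ASet X) :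
    TopCat.PrelocalPredicate fun x => Dual (X.stalk x) (L.stalk x) where
  pred {U} f := ∀ (V : Opens X.carrier) (h : V ≤ U) (l : L.Γ V), ∃ a : X.Γ V,
    ∀ y : V, (f ⟨y.1, h y.2⟩).1 (germ y.2 l) = germ y.2 a
  res i _ h V hV l := h V (hV.trans i.le) l

/-- The dual `L⁻¹`, i.e. the sheaf of homomorphisms `ℋom(L, 𝒜)`. -/
def dual (L : ASet X) : ASet X :=
  ofFibers (dualPre L)
    (fun _ _ _ => ⟨0, fun y => (MonoidedSpace.germ_zero y.2).symm⟩)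
    (fun _ a _ hf V h l => by
      obtain ⟨b, hb⟩ := hf V h l
      refine ⟨res h a * b, fun y => ?_⟩
      rw [MonoidedSpace.germ_mul, ← hb, germ_res]
      rfl)

section DualLemmas

variable {L : ASet X}

/-- The canonical map from the stalk of `L⁻¹` to the dual of the stalk of `L`. -/
def dualValue (L : ASet X) (x : X.carrier) : (dual L).stalk x → Dual (X.stalk x) (L.stalk x) :=
  value (P := dualPre L) x

theorem dualValue_smul {x : X.carrier} (a : X.stalk x) (s : (dual L).stalk x) :
    dualValue L x (a • s) = a • dualValue L x s := value_smul a s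

theorem dualValue_germ {U : Opens X.carrier} {x : X.carrier} (hx : x ∈ U) (s : (dual L).Γ U) :
    dualValue L x (germ hx s) = s.1 ⟨x, hx⟩ := value_germ hx s

theorem exists_eval {U : Opens X.carrier} (s : (dual L).Γ U) (l : L.Γ U) {x : X.carrier}
    (hx : x ∈ U) : ∃ (V : Opens X.carrier) (h : V ≤ U) (_ : x ∈ V) (a : X.Γ V),
      ∀ y (hy : y ∈ V), (dualValue L y (germ (h hy) s)).1 (germ (h hy) l) = germ hy a := by
  obtain ⟨V, hV, i, h⟩ := s.2 ⟨x, hx⟩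
  obtain ⟨a, ha⟩ := h V le_rfl (res i.le l)
  refine ⟨V, i.le, hV, a, fun y hy => ?_⟩
  rw [dualValue_germ, ← ha ⟨y, hy⟩, germ_res]
  rfl

variable {U : Opens X.carrier}

/-- The generator of `L|_U` corresponding to `1` under an isomorphism `L|_U ≅ 𝒜|_U`. -/
def gen (e : IsoOn U L (unit X)) : L.Γ U := (e.toEquiv U le_rfl).symm (1 : X.Γ U)

/-- The coordinate of an element of the stalk. -/
def coord (e : IsoOn U L (unit X)) (x : X.carrier) (l : L.stalk x) : X.stalk x := e.stalkMap x l

theorem coord_smul (e : IsoOn U L (unit X)) {x : X.carrier} (hx : x ∈ U) (a : X.stalk x)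
    (l : L.stalk x) : coord e x (a • l) = a * coord e x l := e.stalkMap_smul hx a l

theorem coord_germ (e : IsoOn U L (unit X)) {V : Opens X.carrier} (hV : V ≤ U) {x : X.carrier}
    (hx : x ∈ V) (l : L.Γ V) :
    coord e x (germ hx l) = germ (F := X.sheaf) hx (e.toEquiv V hV l) := e.stalkMap_germ hV hx l

theorem coord_gen (e : IsoOn U L (unit X)) {x : X.carrier} (hx : x ∈ U) :
    coord e x (germ hx (gen e)) = 1 := by
  rw [coord_germ e le_rfl hx]
  exact (congrArg (germ (F := X.sheaf) hx) (Equiv.apply_symm_apply (e.toEquiv U le_rfl) _)).trans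
    (MonoidedSpace.germ_one hx)

theorem coord_smul_gen (e : IsoOn U L (unit X)) {x : X.carrier} (hx : x ∈ U) (l : L.stalk x) :
    coord e x l • germ hx (gen e) = l := by
  apply (e.stalkMap_bijective hx).1
  change coord e x _ = coord e x l
  rw [coord_smul e hx, coord_gen, mul_one]

/-- Evaluation at the generator. -/
theorem eval_gen_bijective (e : IsoOn U L (unit X)) {x : X.carrier} (hx : x ∈ U) :
    Function.Bijective fun t => (dualValue L x t).1 (germ hx (gen e)) := by
  have hval : ∀ y (hy : y ∈ U) (f : Dual (X.stalk y) (L.stalk y)) l,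
      f.1 l = coord e y l * f.1 (germ hy (gen e)) := fun y hy f l => by
    rw [← f.2, coord_smul_gen]
  constructor
  · intro t t' h
    obtain ⟨V, hV, s, s', rfl, rfl⟩ := exists_germ₂ t t'
    have hx' : x ∈ U ⊓ V := ⟨hx, hV⟩
    rw [← germ_res inf_le_right hx' s, ← germ_res inf_le_right hx' s'] at h ⊢
    generalize res inf_le_right s = s at *
    generalize res inf_le_right s' = s' at *
    obtain ⟨W, i, hW, a, ha⟩ := exists_eval s (res inf_le_left (gen e)) hx'
    obtain ⟨W', i', hW', a', ha'⟩ := exists_eval s' (res inf_le_left (gen e)) hx'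
    have h1 := ha x hW
    have h2 := ha' x hW'
    rw [germ_res] at h1 h2
    obtain ⟨W'', hW'', j, j', hj⟩ := germ_eq (h1.symm.trans (h.trans h2))
    rw [← germ_res (j.trans i) hW'' s, ← germ_res (j'.trans i') hW'' s']
    refine congrArg _ (Subtype.ext (funext fun y => ?_))
    have k1 := ha y (j y.2)
    have k2 := ha' y (j' y.2)
    rw [← germ_res j y.2 a, hj, germ_res j' y.2, ← k2, germ_res, dualValue_germ,
      dualValue_germ] at k1
    refine Dual.ext (funext fun l => ?_)
    change (s.1 ⟨y.1, i (j y.2)⟩).1 l = (s'.1 ⟨y.1, i (j y.2)⟩).1 l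
    rw [hval y (i (j y.2)).1, k1, ← hval]
  · intro a
    obtain ⟨V, hV, a, rfl⟩ := exists_germ a
    have hx' : x ∈ U ⊓ V := ⟨hx, hV⟩
    let f : ∀ y : (U ⊓ V : Opens X.carrier), Dual (X.stalk y) (L.stalk y) := fun y =>
      ⟨fun l => coord e y l * germ y.2.2 a, fun b l =>
        (congrArg (· * germ y.2.2 a) (coord_smul e y.2.1 b l)).trans (mul_assoc _ _ _)⟩
    have hf : (dualPre L).pred f := by
      intro W hW l
      refine ⟨(show X.Γ W from e.toEquiv W (hW.trans inf_le_left) l) *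
        res (hW.trans inf_le_right) a, fun y => ?_⟩
      rw [MonoidedSpace.germ_mul, germ_res]
      exact congrArg (· * germ (hW y.2).2 a) (coord_germ e (hW.trans inf_le_left) y.2 l)
    refine ⟨germ hx' (⟨f, TopCat.PrelocalPredicate.sheafifyOf hf⟩ : (dual L).Γ (U ⊓ V)), ?_⟩
    refine (congrArg (fun g : Dual (X.stalk x) (L.stalk x) => g.1 (germ hx (gen e)))
      (dualValue_germ hx' _)).trans ?_
    change coord e x (germ hx (gen e)) * germ hV a = _
    rw [coord_gen, one_mul]

theorem IsInvertible.dual (hL : L.IsInvertible) : (dual L).IsInvertible := by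
  intro x
  obtain ⟨U, hU, ⟨e⟩⟩ := hL x
  refine ⟨U, hU, ?_⟩
  classical
  let φ : ∀ x, (ASet.dual L).stalk x → (unit X).stalk x := fun x t =>
    if hx : x ∈ U then (dualValue L x t).1 (germ hx (gen e)) else (0 : X.stalk x)
  have hφ : ∀ x (hx : x ∈ U), φ x = fun t => (dualValue L x t).1 (germ hx (gen e)) :=
    fun x hx => funext fun t => dif_pos hx
  refine IsoOn.nonempty_of_stalks φ (fun x hx => ?_) (fun x hx a s => ?_) (fun V hV s x hx => ?_)
  · rw [hφ x hx]; exact eval_gen_bijective e hx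
  · rw [hφ x hx]
    dsimp only
    rw [dualValue_smul, Dual.smul_val]
    rfl
  · obtain ⟨W, hW, hxW, a, ha⟩ := exists_eval s (res hV (gen e)) hx
    refine ⟨W, hW, hxW, a, fun y hy => ?_⟩
    rw [hφ y (hV (hW hy))]
    refine Eq.trans ?_ (ha y hy)
    rw [germ_res]

theorem IsInvertible.nonempty_smash_dual (hL : L.IsInvertible) :
    Nonempty (Iso (ASet.smash L (ASet.dual L)) (unit X)) := by
  let φ : ∀ x, SmashOver (X.stalk x) (L.stalk x) ((ASet.dual L).stalk x) → X.stalk x := fun x =>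
    SmashOver.lift (fun l t => (dualValue L x t).1 l) (fun a l t => by
      rw [dualValue_smul, (dualValue L x t).2, Dual.smul_val])
  refine nonempty_smash_iso φ (fun x _ => ?_) (fun x _ a l t => (dualValue L x t).2 a l)
    (fun V hV l s x hx => exists_eval s l hx)
  obtain ⟨U, hU, ⟨e⟩⟩ := hL x
  have hgen : ∀ s : SmashOver (X.stalk x) (L.stalk x) ((ASet.dual L).stalk x),
      ∃ t, s = .mk (germ hU (gen e)) t := SmashOver.ind fun l t =>
    ⟨coord e x l • t, by rw [← SmashOver.mk_smul, coord_smul_gen]⟩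
  constructor
  · intro s s' h
    obtain ⟨t, rfl⟩ := hgen s
    obtain ⟨t', rfl⟩ := hgen s'
    exact congrArg _ ((eval_gen_bijective e hU).1 h)
  · intro a
    obtain ⟨t, ht⟩ := (eval_gen_bijective e hU).2 a
    exact ⟨.mk _ t, ht⟩

end DualLemmas

end ASet

/-! ### The Picard group -/

/-- Invertible sheaves on a monoided space. -/
def InvertibleSheaf (X : MonoidedSpace.{u}) : Type (u + 1) := {L : ASet X // L.IsInvertible}

instance InvertibleSheaf.setoid (X : MonoidedSpace.{u}) : Setoid (InvertibleSheaf X) where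
  r L M := Nonempty (ASet.Iso L.1 M.1)
  iseqv := ⟨fun _ => ⟨.refl _ _⟩, fun ⟨e⟩ => ⟨e.symm⟩, fun ⟨e⟩ ⟨f⟩ => ⟨e.trans f⟩⟩

/-- The Picard group: isomorphism classes of invertible sheaves. -/
def Pic (X : MonoidedSpace.{u}) : Type (u + 1) :=
  _root_.Quotient (InvertibleSheaf.setoid X)

namespace Pic

variable {X : MonoidedSpace.{u}}

/-- The class of an invertible sheaf. -/
def mk (L : InvertibleSheaf X) : Pic X := _root_.Quotient.mk _ L

theorem mk_eq {L M : InvertibleSheaf X} : mk L = mk M ↔ Nonempty (ASet.Iso L.1 M.1) :=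
  _root_.Quotient.eq

theorem ind {p : Pic X → Prop} (h : ∀ L, p (mk L)) (a : Pic X) : p a := _root_.Quotient.ind h a

/-- The product of `Pic X` is induced by the smash product. -/
instance : Mul (Pic X) :=
  ⟨_root_.Quotient.map₂ (fun L M => ⟨L.1.smash M.1, L.2.smash M.2⟩)
    fun _ _ ⟨e⟩ _ _ ⟨f⟩ => ASet.nonempty_smash_congr e f⟩

theorem mk_mul (L M : InvertibleSheaf X) : mk L * mk M = mk ⟨L.1.smash M.1, L.2.smash M.2⟩ := rfl

instance : One (Pic X) := ⟨mk ⟨.unit X, ASet.isInvertible_unit X⟩⟩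

/-- The dual of an invertible sheaf is determined up to isomorphism as its inverse. -/
theorem dual_congr {L M : InvertibleSheaf X} (h : Nonempty (ASet.Iso L.1 M.1)) :
    Nonempty (ASet.Iso L.1.dual M.1.dual) := by
  obtain ⟨e⟩ := h
  obtain ⟨a1⟩ := ASet.nonempty_unit_smash L.1.dual
  obtain ⟨a2⟩ := M.2.nonempty_smash_dual
  obtain ⟨a3⟩ := ASet.nonempty_smash_congr a2.symm (.refl ⊤ L.1.dual)
  obtain ⟨a4⟩ := ASet.nonempty_smash_comm M.1 M.1.dual
  obtain ⟨a5⟩ := ASet.nonempty_smash_congr a4 (.refl ⊤ L.1.dual)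
  obtain ⟨a6⟩ := ASet.nonempty_smash_assoc M.1.dual M.1 L.1.dual
  obtain ⟨a7⟩ := ASet.nonempty_smash_congr e.symm (.refl ⊤ L.1.dual)
  obtain ⟨a8⟩ := L.2.nonempty_smash_dual
  obtain ⟨a9⟩ := ASet.nonempty_smash_congr (.refl ⊤ M.1.dual) (a7.trans a8)
  obtain ⟨a10⟩ := ASet.nonempty_smash_comm M.1.dual (.unit X)
  obtain ⟨a11⟩ := ASet.nonempty_unit_smash M.1.dual
  exact ⟨a1.symm.trans (a3.trans (a5.trans (a6.trans (a9.trans (a10.trans a11)))))⟩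

/-- The Picard group is an abelian group. -/
instance : CommGroup (Pic X) where
  mul_assoc := ind fun L => ind fun M => ind fun N =>
    mk_eq.2 (ASet.nonempty_smash_assoc L.1 M.1 N.1)
  mul_comm := ind fun L => ind fun M => mk_eq.2 (ASet.nonempty_smash_comm L.1 M.1)
  one_mul := ind fun L => mk_eq.2 (ASet.nonempty_unit_smash L.1)
  mul_one := ind fun L => mk_eq.2 (by
    obtain ⟨e⟩ := ASet.nonempty_smash_comm L.1 (.unit X)
    obtain ⟨f⟩ := ASet.nonempty_unit_smash L.1
    exact ⟨e.trans f⟩)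
  inv := _root_.Quotient.map (fun L => ⟨L.1.dual, L.2.dual⟩) fun _ _ h => dual_congr h
  inv_mul_cancel := ind fun L => mk_eq.2 (by
    obtain ⟨e⟩ := ASet.nonempty_smash_comm L.1.dual L.1
    obtain ⟨f⟩ := L.2.nonempty_smash_dual
    exact ⟨e.trans f⟩)

end Pic

/-! ### Morphisms and the pull-back of invertible sheaves -/

namespace MonoidedSpace

/-- Morphisms of monoided spaces. (A morphism of monoid schemes is moreover local on stalks; this
plays no role for the pull-back of sheaves.) -/
structure Hom (Y X : MonoidedSpace.{u}) where
  base : C(Y.carrier, X.carrier)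
  comap : ∀ U : Opens X.carrier, X.Γ U →*₀ Y.Γ (Opens.comap base U)
  comap_res : ∀ {U V : Opens X.carrier} (h : U ≤ V) (a : X.Γ V),
    comap U (res h a) = res (show Opens.comap base U ≤ Opens.comap base V from fun _ hy => h hy)
      (comap V a)

namespace Hom

variable {X Y : MonoidedSpace.{u}} (f : Hom Y X)

/-- The preimage of an open set. -/
abbrev preim (U : Opens X.carrier) : Opens Y.carrier := Opens.comap f.base U

variable {f} in
theorem mem_preim {U : Opens X.carrier} {y : Y.carrier} : y ∈ f.preim U ↔ f.base y ∈ U := Iff.rfl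

theorem exists_stalkMap (y : Y.carrier) : ∃ φ : X.stalk (f.base y) → Y.stalk y,
    ∀ (U : Opens X.carrier) (hy : f.base y ∈ U) (a : X.Γ U),
      φ (germ hy a) = germ (mem_preim.2 hy) (f.comap U a) := by
  choose U hU a ha using fun t : X.stalk (f.base y) => exists_germ t
  refine ⟨fun t => germ (mem_preim.2 (hU t)) (f.comap _ (a t)), fun V hV b => ?_⟩
  obtain ⟨W, hW, i, j, e⟩ := germ_eq (ha (germ hV b))
  have hW' : y ∈ f.preim W := hW
  dsimp only
  rw [← germ_res (show f.preim W ≤ f.preim V from fun _ hy => j hy) hW' (f.comap V b),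
    ← f.comap_res j, ← e, f.comap_res i, germ_res]

/-- The homomorphism of stalks `𝒜_{X, f(y)} → 𝒜_{Y, y}`. -/
def stalkMap (y : Y.carrier) : X.stalk (f.base y) →*₀ Y.stalk y where
  toFun := (f.exists_stalkMap y).choose
  map_zero' := by
    have h := (f.exists_stalkMap y).choose_spec ⊤ (Opens.mem_top _) 0
    rw [map_zero, germ_zero, germ_zero] at h
    exact h
  map_one' := by
    have h := (f.exists_stalkMap y).choose_spec ⊤ (Opens.mem_top _) 1
    rw [map_one, germ_one, germ_one] at h
    exact h
  map_mul' s t := by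
    obtain ⟨U, hU, a, b, rfl, rfl⟩ := exists_germ₂ s t
    have h := (f.exists_stalkMap y).choose_spec U hU
    rw [← germ_mul, h, h, h, map_mul, germ_mul]

variable {f}

theorem stalkMap_germ {U : Opens X.carrier} {y : Y.carrier} (hy : f.base y ∈ U) (a : X.Γ U) :
    f.stalkMap y (germ hy a) = germ (mem_preim.2 hy) (f.comap U a) :=
  (f.exists_stalkMap y).choose_spec U hy a

end Hom

end MonoidedSpace

namespace ASet

open MonoidedSpace

variable {X Y : MonoidedSpace.{u}}

/-- The families `y ↦ b_y ∧ l_{f(y)}` given by sections `b` of `𝒜_Y` and `l` of `L`. -/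
def pullbackPre (f : Hom Y X) (L : ASet X) :
    TopCat.PrelocalPredicate fun y => BaseChange (f.stalkMap y) (L.stalk (f.base y)) where
  pred {W} h := ∃ (b : Y.Γ W) (U : Opens X.carrier) (hU : W ≤ f.preim U) (l : L.Γ U),
    ∀ y : W, h y = .mk _ (germ y.2 b) (germ (Hom.mem_preim.1 (hU y.2)) l)
  res := by
    rintro W W' i h ⟨b, U, hU, l, hl⟩
    exact ⟨res i.le b, U, i.le.trans hU, l, fun y => by rw [germ_res]; exact hl _⟩

/-- The pull-back `f^*L = 𝒜_Y ∧_{f^{-1}𝒜_X} f^{-1}L` of a sheaf of `𝒜_X`-sets: its sections are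
the families of elements of the stalks `𝒜_{Y,y} ∧_{𝒜_{X,f(y)}} L_{f(y)}` which locally are of
the form `y ↦ b_y ∧ l_{f(y)}`. -/
def pullback (f : Hom Y X) (L : ASet X) : ASet Y :=
  ofFibers (pullbackPre f L)
    ⟨0, ⊤, fun _ _ => trivial, 0, fun y => by
      rw [MonoidedSpace.germ_zero, germ_zero]; rfl⟩
    (by
      rintro W a h ⟨b, U, hU, l, hl⟩
      refine ⟨a * b, U, hU, l, fun y => ?_⟩
      change germ y.2 a • h y = _
      rw [hl y, BaseChange.smul_mk, MonoidedSpace.germ_mul])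

section PullbackLemmas

variable {f : Hom Y X} {L : ASet X}

/-- The section `b ∧ l` of `f^*L`. -/
def pullbackPure {W : Opens Y.carrier} {U : Opens X.carrier} (hU : W ≤ f.preim U)
    (b : Y.Γ W) (l : L.Γ U) : (pullback f L).Γ W :=
  ⟨fun y => .mk _ (germ y.2 b) (germ (Hom.mem_preim.1 (hU y.2)) l),
    TopCat.PrelocalPredicate.sheafifyOf ⟨b, U, hU, l, fun _ => rfl⟩⟩

variable (f L) in
/-- The canonical map `(f^*L)_y → 𝒜_{Y,y} ∧ L_{f(y)}`. -/
def pullbackValue (y : Y.carrier) :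
    (pullback f L).stalk y → BaseChange (f.stalkMap y) (L.stalk (f.base y)) :=
  value (P := pullbackPre f L) y

theorem pullbackValue_smul {y : Y.carrier} (a : Y.stalk y) (s : (pullback f L).stalk y) :
    pullbackValue f L y (a • s) = a • pullbackValue f L y s := value_smul a s

theorem pullbackValue_pure {W : Opens Y.carrier} {U : Opens X.carrier} (hU : W ≤ f.preim U)
    (b : Y.Γ W) (l : L.Γ U) {y : Y.carrier} (hy : y ∈ W) :
    pullbackValue f L y (germ hy (pullbackPure hU b l)) =
      .mk _ (germ hy b) (germ (Hom.mem_preim.1 (hU hy)) l) :=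
  value_germ hy _

theorem exists_pullbackPure {W : Opens Y.carrier} (s : (pullback f L).Γ W) {y : Y.carrier}
    (hy : y ∈ W) : ∃ (V : Opens Y.carrier) (h : V ≤ W) (_ : y ∈ V) (U : Opens X.carrier)
      (hU : V ≤ f.preim U) (b : Y.Γ V) (l : L.Γ U), res h s = pullbackPure hU b l := by
  obtain ⟨V, hV, i, b, U, hU, l, h⟩ := s.2 ⟨y, hy⟩
  exact ⟨V, i.le, hV, U, hU, b, l, Subtype.ext (funext h)⟩

theorem res_pullbackPure {W W' : Opens Y.carrier} {U U' : Opens X.carrier} (hU : W ≤ f.preim U)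
    (h : W' ≤ W) (h' : U' ≤ U) (hU' : W' ≤ f.preim U') (b : Y.Γ W) (l : L.Γ U) :
    res h (pullbackPure hU b l) = pullbackPure hU' (res h b) (res h' l) :=
  Subtype.ext (funext fun y => by
    change BaseChange.mk _ _ _ = BaseChange.mk _ _ _
    rw [germ_res, germ_res])

theorem pullbackValue_bijective (y : Y.carrier) : Function.Bijective (pullbackValue f L y) := by
  choose W hW b hb using fun t : Y.stalk y => exists_germ t
  choose U hU l hl using fun t : L.stalk (f.base y) => exists_germ t
  have hWU : ∀ s t, y ∈ W s ⊓ f.preim (U t) := fun s t => ⟨hW s, hU t⟩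
  let g₀ : Y.stalk y → L.stalk (f.base y) → (pullback f L).stalk y := fun s t =>
    germ (hWU s t) (pullbackPure inf_le_right (res inf_le_left (b s)) (l t))
  have hg₀ : ∀ (W' : Opens Y.carrier) (U' : Opens X.carrier) (h : W' ≤ f.preim U') (hy : y ∈ W')
      (b' : Y.Γ W') (l' : L.Γ U'), g₀ (germ hy b') (germ (Hom.mem_preim.1 (h hy)) l') =
        germ hy (pullbackPure h b' l') := by
    intro W' U' h hy b' l'
    have hy' : f.base y ∈ U' := h hy
    obtain ⟨V, hV, i, j, e⟩ := germ_eq (hb (germ hy b'))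
    obtain ⟨V', hV', i', j', e'⟩ := germ_eq (hl (germ hy' l'))
    have hyV : y ∈ V ⊓ f.preim V' := ⟨hV, hV'⟩
    have h1 : V ⊓ f.preim V' ≤ f.preim V' := inf_le_right
    have h2 : V ⊓ f.preim V' ≤ W (germ hy b') ⊓ f.preim (U (germ hy' l')) :=
      fun z hz => ⟨i hz.1, i' hz.2⟩
    have h3 : V ⊓ f.preim V' ≤ W' := fun z hz => j hz.1
    change germ (hWU (germ hy b') (germ hy' l')) _ = _
    refine (germ_res h2 hyV _).symm.trans (Eq.trans (congrArg (germ hyV) ?_) (germ_res h3 hyV _))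
    refine (res_pullbackPure _ h2 i' h1 _ _).trans
      (Eq.trans (congrArg₂ (pullbackPure h1) ?_ e') (res_pullbackPure _ h3 j' h1 _ _).symm)
    rw [res_res, ← res_res inf_le_left i, e, res_res]
  have hbal : ∀ (a : X.stalk (f.base y)) s t, g₀ (s * f.stalkMap y a) t = g₀ s (a • t) := by
    intro a s t
    obtain ⟨U₁, hU₁, a, t, rfl, rfl⟩ := exists_germ₂ a t
    obtain ⟨W₁, hW₁, s, rfl⟩ := exists_germ s
    have hy : y ∈ W₁ ⊓ f.preim U₁ := ⟨hW₁, hU₁⟩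
    rw [Hom.stalkMap_germ, ← germ_res inf_le_left hy s,
      ← germ_res inf_le_right hy (f.comap U₁ a), ← MonoidedSpace.germ_mul, ← germ_smul,
      hg₀ _ _ inf_le_right hy, hg₀ _ _ inf_le_right hy]
    refine congrArg _ (Subtype.ext (funext fun z => ?_))
    change BaseChange.mk _ _ _ = BaseChange.mk _ _ _
    have hz : f.base z.1 ∈ U₁ := z.2.2
    rw [MonoidedSpace.germ_mul, germ_smul, ← BaseChange.mk_mul, Hom.stalkMap_germ, germ_res,
      germ_res]
  let g := BaseChange.lift g₀ hbal
  refine ⟨Function.LeftInverse.injective (g := g) fun s => ?_, BaseChange.ind fun s t => ?_⟩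
  · obtain ⟨W₁, hW₁, s, rfl⟩ := exists_germ s
    obtain ⟨V, h, hV, U₁, hU₁, b₁, l₁, e⟩ := exists_pullbackPure s hW₁
    rw [← germ_res h hV, e, pullbackValue_pure]
    exact hg₀ _ _ hU₁ hV _ _
  · obtain ⟨U₁, hU₁, t, rfl⟩ := exists_germ t
    obtain ⟨W₁, hW₁, s, rfl⟩ := exists_germ s
    have hy : y ∈ W₁ ⊓ f.preim U₁ := ⟨hW₁, hU₁⟩
    refine ⟨_, (pullbackValue_pure inf_le_right (res inf_le_left s) t hy).trans ?_⟩
    rw [germ_res]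

theorem nonempty_pullback_iso {N : ASet Y} {U : Opens X.carrier}
    (φ : ∀ y, BaseChange (f.stalkMap y) (L.stalk (f.base y)) → N.stalk y)
    (hbij : ∀ y ∈ f.preim U, Function.Bijective (φ y))
    (hsmul : ∀ y ∈ f.preim U, ∀ (a b : Y.stalk y) l, φ y (.mk _ (a * b) l) = a • φ y (.mk _ b l))
    (hsec : ∀ (V : Opens X.carrier), V ≤ U → ∀ (W : Opens Y.carrier) (h : W ≤ f.preim V)
      (b : Y.Γ W) (l : L.Γ V), ∃ t : N.Γ W, ∀ (y) (hy : y ∈ W),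
        φ y (.mk _ (germ hy b) (germ (Hom.mem_preim.1 (h hy)) l)) = germ hy t) :
    Nonempty (IsoOn (f.preim U) (pullback f L) N) := by
  refine IsoOn.nonempty_of_stalks (fun y s => φ y (pullbackValue f L y s))
    (fun y hy => (hbij y hy).comp (pullbackValue_bijective y)) (fun y hy a s => ?_)
    (fun W hW s y hy => ?_)
  · rw [pullbackValue_smul]
    obtain ⟨⟨b, l⟩, h⟩ := Quot.exists_rep (pullbackValue f L y s)
    rw [← h]
    exact hsmul y hy a b l
  · obtain ⟨V, h, hV, U₁, hU₁, b, l, e⟩ := exists_pullbackPure s hy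
    have h' : V ≤ f.preim (U₁ ⊓ U) := fun z hz => ⟨hU₁ hz, hW (h hz)⟩
    obtain ⟨t, ht⟩ := hsec (U₁ ⊓ U) inf_le_right V h' b (res inf_le_left l)
    refine ⟨V, h, hV, t, fun z hz => ?_⟩
    have hz' : f.base z ∈ U₁ ⊓ U := h' hz
    rw [← ht z hz, ← germ_res h hz, e, pullbackValue_pure, germ_res]

theorem nonempty_pullback_of_trivial {U : Opens X.carrier} (e : IsoOn U L (unit X)) :
    Nonempty (IsoOn (f.preim U) (pullback f L) (unit Y)) := by
  classical
  have hbal : ∀ y, y ∈ f.preim U → ∀ (a : X.stalk (f.base y)) (b : Y.stalk y) l,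
      (b * f.stalkMap y a) * f.stalkMap y (coord e _ l) =
        b * f.stalkMap y (coord e _ (a • l)) := by
    intro y hy a b l
    rw [coord_smul e hy, map_mul, mul_assoc]
  let φ : ∀ y, BaseChange (f.stalkMap y) (L.stalk (f.base y)) → Y.stalk y := fun y =>
    if hy : y ∈ f.preim U then
      BaseChange.lift (fun b l => b * f.stalkMap y (coord e _ l)) (hbal y hy)
    else fun _ => 0
  have hφ : ∀ y, y ∈ f.preim U → ∀ b l,
      φ y (.mk _ b l) = b * f.stalkMap y (coord e _ l) := by
    intro y hy b l
    simp only [φ, dif_pos hy, BaseChange.lift_mk]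
  refine nonempty_pullback_iso φ (fun y hy => ?_) (fun y hy a b l => ?_) (fun V hV W h b l => ?_)
  · have hy' : f.base y ∈ U := hy
    refine ⟨Function.LeftInverse.injective
      (g := fun b => .mk _ b (germ hy' (gen e))) (BaseChange.ind fun b l => ?_), fun b =>
        ⟨.mk _ b (germ hy' (gen e)), ?_⟩⟩
    · refine (congrArg (fun b => BaseChange.mk (f.stalkMap y) b (germ hy' (gen e)))
        (hφ y hy b l)).trans ?_
      rw [BaseChange.mk_mul, coord_smul_gen]
    · refine (hφ y hy b _).trans ?_
      rw [coord_gen, map_one]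
      exact mul_one (M := Y.stalk y) b
  · rw [hφ y hy, hφ y hy, mul_assoc]
    rfl
  · refine ⟨b * res h (f.comap V (show X.Γ V from e.toEquiv V hV l)), fun y hy => ?_⟩
    have hy' : f.base y ∈ V := h hy
    rw [hφ y (hV hy')]
    refine Eq.trans ?_ (MonoidedSpace.germ_mul hy _ _).symm
    rw [germ_res, ← Hom.stalkMap_germ hy', coord_germ e hV]

theorem IsInvertible.pullback (hL : L.IsInvertible) (f : Hom Y X) :
    (pullback f L).IsInvertible := by
  intro y
  obtain ⟨U, hU, ⟨e⟩⟩ := hL (f.base y)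
  exact ⟨f.preim U, hU, nonempty_pullback_of_trivial e⟩

end PullbackLemmas

end ASet

/-- The pull-back of an invertible sheaf. -/
def InvertibleSheaf.pullback {X Y : MonoidedSpace.{u}} (f : MonoidedSpace.Hom Y X)
    (L : InvertibleSheaf X) : InvertibleSheaf Y :=
  ⟨L.1.pullback f, L.2.pullback f⟩

/-! ### Monoid schemes -/

/-- Prime ideals of a pointed monoid. -/
@[ext]
structure PrimeIdeal (A : Type u) [CommMonoidWithZero A] where
  carrier : Set A
  zero_mem : 0 ∈ carrier
  mul_mem : ∀ (a : A) {x : A}, x ∈ carrier → a * x ∈ carrier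
  one_notMem : 1 ∉ carrier
  mem_or_mem : ∀ {x y : A}, x * y ∈ carrier → x ∈ carrier ∨ y ∈ carrier

namespace PrimeIdeal

variable {A : Type u} [CommMonoidWithZero A]

/-- The Zariski topology, with basis the sets `D(a) = {p | a ∉ p}`. -/
instance : TopologicalSpace (PrimeIdeal A) :=
  TopologicalSpace.generateFrom (Set.range fun a : A => {p : PrimeIdeal A | a ∉ p.carrier})

/-- The multiplicative set `A ∖ p`. -/
def primeCompl (p : PrimeIdeal A) : Submonoid A where
  carrier := p.carrierᶜ
  one_mem' := p.one_notMem
  mul_mem' ha hb h := (p.mem_or_mem h).elim ha hb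

end PrimeIdeal

/-- The families `p ↦ a / s ∈ A_p` given by a fraction. -/
def fractionPre (A : Type u) [CommMonoidWithZero A] :
    TopCat.PrelocalPredicate (X := TopCat.of (PrimeIdeal A))
      (fun p : PrimeIdeal A => Localization p.primeCompl) where
  pred {U} f := ∃ a s : A, ∀ p : U, ∃ hs : s ∈ p.1.primeCompl, f p = Localization.mk a ⟨s, hs⟩
  res := by
    rintro U V i f ⟨a, s, h⟩
    exact ⟨a, s, fun p => h ⟨p.1, i.le p.2⟩⟩

/-- The affine monoid scheme `MSpec(A)`: the space of prime ideals of `A`, with the sheaf of those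
families of elements of the localizations `A_p` which locally are fractions `a / s`. -/
def MSpec (A : Type u) [CommMonoidWithZero A] : MonoidedSpace.{u} :=
  MonoidedSpace.ofFibers (fractionPre A)
    ⟨0, 1, fun p => ⟨one_mem _, (Localization.mk_zero _).symm⟩⟩
    ⟨1, 1, fun p => ⟨one_mem _, Localization.mk_one.symm⟩⟩
    (by
      rintro U f g ⟨a, s, h⟩ ⟨b, t, k⟩
      refine ⟨a * b, s * t, fun p => ?_⟩
      obtain ⟨hs, hf⟩ := h p
      obtain ⟨ht, hg⟩ := k p
      exact ⟨mul_mem hs ht, by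
        change f p * g p = _
        rw [hf, hg, Localization.mk_mul]; rfl⟩)

/-- The image of an open set under an open embedding. -/
def openImage {X Y : TopCat.{u}} {j : Y → X} (hj : Topology.IsOpenEmbedding j) (V : Opens Y) :
    Opens X :=
  ⟨j '' V, hj.isOpenMap _ V.isOpen⟩

theorem openImage_mono {X Y : TopCat.{u}} {j : Y → X} (hj : Topology.IsOpenEmbedding j)
    {V W : Opens Y} (h : V ≤ W) : openImage hj V ≤ openImage hj W :=
  Set.image_mono h

/-- A monoided space is a monoid scheme if every point has an open neighbourhood isomorphic to
`MSpec(A)` for some `A`: there are an open embedding `j : MSpec(A) → X` of spaces whose image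
contains the point, and isomorphisms `𝒜_X(j(V)) ≅ 𝒜_{MSpec(A)}(V)` compatible with restriction. -/
def MonoidedSpace.IsMonoidScheme (X : MonoidedSpace.{u}) : Prop :=
  ∀ x : X.carrier, ∃ (A : Type u) (_ : CommMonoidWithZero A) (j : (MSpec A).carrier → X.carrier)
    (hj : Topology.IsOpenEmbedding j) (e : ∀ V : Opens (MSpec A).carrier,
      X.Γ (openImage hj V) ≃* (MSpec A).Γ V),
    x ∈ Set.range j ∧ ∀ (V W : Opens (MSpec A).carrier) (h : V ≤ W) (a : X.Γ (openImage hj W)),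
      e V (res (openImage_mono hj h) a) = res h (e W a)

/-! ### Products -/

/-- The congruence on `A × B` which collapses `A × {0} ∪ {0} × B`. -/
def smashCon (A B : Type u) [CommMonoidWithZero A] [CommMonoidWithZero B] : Con (A × B) where
  r p q := p = q ∨ ((p.1 = 0 ∨ p.2 = 0) ∧ (q.1 = 0 ∨ q.2 = 0))
  iseqv := by
    refine ⟨fun _ => .inl rfl, ?_, ?_⟩
    · rintro p q (rfl | ⟨h, k⟩)
      exacts [.inl rfl, .inr ⟨k, h⟩]
    · rintro p q r (rfl | ⟨h, k⟩) (rfl | ⟨h', k'⟩)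
      exacts [.inl rfl, .inr ⟨h', k'⟩, .inr ⟨h, k⟩, .inr ⟨h, k'⟩]
  mul' := by
    have key : ∀ p q : A × B, (p.1 = 0 ∨ p.2 = 0) → ((p * q).1 = 0 ∨ (p * q).2 = 0) := by
      rintro p q (h | h)
      exacts [.inl (by rw [Prod.fst_mul, h, zero_mul]), .inr (by rw [Prod.snd_mul, h, zero_mul])]
    rintro p q p' q' (rfl | ⟨h, k⟩) (rfl | ⟨h', k'⟩)
    · exact .inl rfl
    · right
      rw [mul_comm p p', mul_comm p q']
      exact ⟨key _ _ h', key _ _ k'⟩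
    · exact .inr ⟨key _ _ h, key _ _ k⟩
    · exact .inr ⟨key _ _ h, key _ _ k⟩

/-- The smash product `A ∧ B` of pointed monoids. -/
def SmashMonoid (A B : Type u) [CommMonoidWithZero A] [CommMonoidWithZero B] : Type u :=
  (smashCon A B).Quotient

namespace SmashMonoid

variable {A B : Type u} [CommMonoidWithZero A] [CommMonoidWithZero B]

instance : CommMonoid (SmashMonoid A B) := inferInstanceAs (CommMonoid (smashCon A B).Quotient)

/-- The element `a ∧ b`. -/
def mk (a : A) (b : B) : SmashMonoid A B := ((a, b) : (smashCon A B).Quotient)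

theorem mk_mul (a a' : A) (b b' : B) : mk a b * mk a' b' = mk (a * a') (b * b') := rfl

theorem ind {p : SmashMonoid A B → Prop} (h : ∀ a b, p (mk a b)) (t : SmashMonoid A B) : p t :=
  Quot.ind (fun x => h x.1 x.2) t

theorem mk_eq_iff {a a' : A} {b b' : B} : mk a b = mk a' b' ↔
    (a = a' ∧ b = b') ∨ ((a = 0 ∨ b = 0) ∧ (a' = 0 ∨ b' = 0)) :=
  ((smashCon A B).eq).trans (or_congr_left Prod.mk_inj)

instance : CommMonoidWithZero (SmashMonoid A B) where
  zero := mk 0 0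
  zero_mul := ind fun a b => by
    change mk (0 * a) (0 * b) = mk 0 0
    rw [zero_mul, zero_mul]
  mul_zero := ind fun a b => by
    change mk (a * 0) (b * 0) = mk 0 0
    rw [mul_zero, mul_zero]

end SmashMonoid

namespace MonoidedSpace

/-- The families `(x, y) ↦ a_x ∧ b_y` given by sections `a` of `𝒜_X` and `b` of `𝒜_Y`. -/
def prodPre (X Y : MonoidedSpace.{u}) :
    TopCat.PrelocalPredicate (X := TopCat.of (X.carrier × Y.carrier))
      (fun z : X.carrier × Y.carrier => SmashMonoid (X.stalk z.1) (Y.stalk z.2)) where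
  pred {W} f := ∃ (U : Opens X.carrier) (V : Opens Y.carrier) (hU : ∀ z : W, z.1.1 ∈ U)
    (hV : ∀ z : W, z.1.2 ∈ V) (a : X.Γ U) (b : Y.Γ V),
      ∀ z : W, f z = .mk (germ (hU z) a) (germ (hV z) b)
  res := by
    rintro W W' i f ⟨U, V, hU, hV, a, b, h⟩
    exact ⟨U, V, fun z => hU ⟨z.1, i.le z.2⟩, fun z => hV ⟨z.1, i.le z.2⟩, a, b, fun z => h ⟨z.1, i.le z.2⟩⟩

/-- The product `X × Y`: the product space, with the sheaf of those families of elements of the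
smash products `𝒜_{X,x} ∧ 𝒜_{Y,y}` which locally are of the form `(x, y) ↦ a_x ∧ b_y` for sections
`a`, `b`. For affine monoid schemes it is `MSpec(A) × MSpec(B) = MSpec(A ∧ B)`. -/
def prod (X Y : MonoidedSpace.{u}) : MonoidedSpace.{u} :=
  ofFibers (prodPre X Y)
    ⟨⊤, ⊤, fun _ => Opens.mem_top _, fun _ => Opens.mem_top _, 0, 0, fun z =>
      (congrArg₂ SmashMonoid.mk (germ_zero _) (germ_zero _)).symm⟩
    ⟨⊤, ⊤, fun _ => Opens.mem_top _, fun _ => Opens.mem_top _, 1, 1, fun z =>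
      (congrArg₂ SmashMonoid.mk (germ_one _) (germ_one _)).symm⟩
    (by
      rintro W f g ⟨U, V, hU, hV, a, b, h⟩ ⟨U', V', hU', hV', a', b', h'⟩
      have hUU : ∀ z : W, z.1.1 ∈ U ⊓ U' := fun z => ⟨hU z, hU' z⟩
      have hVV : ∀ z : W, z.1.2 ∈ V ⊓ V' := fun z => ⟨hV z, hV' z⟩
      refine ⟨U ⊓ U', V ⊓ V', hUU, hVV, res inf_le_left a * res inf_le_right a',
        res inf_le_left b * res inf_le_right b', fun z => ?_⟩
      change f z * g z = _
      rw [h, h', SmashMonoid.mk_mul, germ_mul, germ_mul, germ_res, germ_res, germ_res, germ_res])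

/-- The projection `X × Y → X`. -/
def fst (X Y : MonoidedSpace.{u}) : Hom (X.prod Y) X where
  base := ⟨Prod.fst, continuous_fst⟩
  comap U :=
    { toFun := fun a => ⟨fun z => .mk (germ (show z.1.1 ∈ U from z.2) a) 1,
        TopCat.PrelocalPredicate.sheafifyOf ⟨U, ⊤, fun z => z.2, fun _ => Opens.mem_top _, a, 1,
          fun z => congrArg (SmashMonoid.mk _) (germ_one _).symm⟩⟩
      map_zero' := Subtype.ext (funext fun z => by
        change SmashMonoid.mk _ _ = SmashMonoid.mk 0 0
        rw [germ_zero, SmashMonoid.mk_eq_iff]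
        exact .inr ⟨.inl rfl, .inl rfl⟩)
      map_one' := Subtype.ext (funext fun z => by
        change SmashMonoid.mk _ _ = SmashMonoid.mk 1 1
        rw [germ_one])
      map_mul' := fun a b => Subtype.ext (funext fun z => by
        change SmashMonoid.mk _ _ = SmashMonoid.mk _ _ * SmashMonoid.mk _ _
        rw [SmashMonoid.mk_mul, germ_mul, mul_one]) }
  comap_res h a := Subtype.ext (funext fun z => by
    change SmashMonoid.mk _ _ = SmashMonoid.mk _ _
    rw [germ_res])

end MonoidedSpace

/-- The affine line `𝔸¹ = MSpec(T)`, where `T = {0, 1, t, t², …}` is the free pointed monoid on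
one generator `t`. -/
def affineLine : MonoidedSpace.{u} := MSpec (ULift.{u} (WithZero (Multiplicative ℕ)))

end

end MonoidScheme

namespace MonoidScheme

open CategoryTheory TopologicalSpace Opposite

noncomputable section

/-! The affine line has a point, the origin `t = 0`, whose only open neighbourhood is the whole
line, and the stalk there is `T` itself. Write `p` for the projection and `(x, 0)` for the point of
the zero section over `x`. Every neighbourhood of `(x, 0)` then contains a tube `p⁻¹(U)` with `x ∈
U` (`MonoidedSpace.exists_preim_le`), and every point of the cylinder is a generization of the point
of the zero section below it (`MonoidedSpace.specializes_zeroPt`). So an invertible sheaf on the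
cylinder is determined by its behaviour along the zero section, and it is trivial on tubes.

The stalk at `(x, 0)` embeds in `𝒜_x ∧ T`. Since `1` is the only unit of `T`, each unit of this
stalk comes from `𝒜_x` (`MonoidedSpace.exists_stalkMap_of_mul_eq_one`). This is where monoids are
simpler than rings: no hypothesis on `X` such as normality or reducedness is needed to control the
units.

Surjectivity is descent. Two generators of an invertible `M` over a tube differ near the zero
section by a unit, hence locally by a function on `X`. The multiples of generators by functions on
`X` therefore form an invertible sheaf `ASet.descent M` on `X`, and specialization of germs from the
zero section identifies its pull-back with `M`.

Injectivity uses the retraction `𝒜_x ∧ T → 𝒜_x` sending every nonzero element of `T` to `1`. A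
trivialization of `p^*L`, evaluated on the elements `1 ∧ l` along the zero section and followed by
the retraction, trivializes `L`.

Throughout, isomorphisms are built on stalks. Invertible sheaves have stalks with a free generator,
and an equivariant map which takes one free generator to another is bijective.
`ASet.nonempty_pullback_iso_of_isGen` turns this into a criterion for being a pull-back, which also
shows that `p^*` is a well-defined homomorphism. -/

/-- `m` generates the `A`-set `M` freely. -/
def IsGen (A : Type u) {M : Type u} [SMul A M] (m : M) : Prop :=
  Function.Bijective fun a : A => a • m

/-! ### Free `A`-sets on one generator -/

section Algebra

variable {A B M N : Type u} [CommMonoidWithZero A] [CommMonoidWithZero B] [Zero M] [Zero N]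
  [MulActionWithZero A M] [MulActionWithZero A N]

/-- The coordinate with respect to a free generator. -/
theorem IsGen.exists_coord {m : M} (hm : IsGen A m) :
    ∃ c : M → A, (∀ n, c n • m = n) ∧ (∀ (a : A) n, c (a • n) = a * c n) ∧ c m = 1 := by
  choose c hc using hm.2
  exact ⟨c, hc, fun a n => hm.1 ((hc _).trans (by
    change a • n = (a * c n) • m
    rw [mul_smul]; exact congrArg _ (hc n).symm)),
    hm.1 ((hc _).trans (one_smul A m).symm)⟩

/-- The inverse of `b ↦ b • (1 ∧ m)` is `b ∧ n ↦ b φ(c(n))`, where `c` is the coordinate with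
respect to `m`; equivariance of `c` makes it balanced. -/
theorem BaseChange.isGen (φ : A →*₀ B) {m : M} (hm : IsGen A m) :
    IsGen B (BaseChange.mk φ 1 m) := by
  obtain ⟨c, hc, hs, h1⟩ := hm.exists_coord
  refine ⟨Function.LeftInverse.injective
    (g := BaseChange.lift (fun b n => b * φ (c n)) fun a b n => ?_) fun b => ?_,
    BaseChange.ind fun b n => ⟨b * φ (c n), ?_⟩⟩
  · rw [hs, map_mul, mul_assoc]
  · change b * 1 * φ (c m) = b
    rw [h1, map_one, mul_one, mul_one]
  · change BaseChange.mk φ (b * φ (c n) * 1) m = _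
    rw [mul_one, BaseChange.mk_mul, hc]

/-- The product of the two coordinates is balanced, and it is the coordinate with respect to `m ∧
n`. -/
theorem SmashOver.isGen {m : M} {n : N} (hm : IsGen A m) (hn : IsGen A n) :
    IsGen A (SmashOver.mk m n : SmashOver A M N) := by
  obtain ⟨c, hc, hs, h1⟩ := hm.exists_coord
  obtain ⟨d, hd, ht, h2⟩ := hn.exists_coord
  refine ⟨Function.LeftInverse.injective
    (g := SmashOver.lift (fun m n => c m * d n) fun a m n => ?_) fun a => ?_,
    SmashOver.ind fun m' n' => ⟨c m' * d n', ?_⟩⟩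
  · rw [hs, ht, mul_left_comm, mul_assoc]
  · change c (a • m) * d n = a
    rw [hs, h1, h2, mul_one, mul_one]
  · change (SmashOver.mk ((c m' * d n') • m) n : SmashOver A M N) = _
    rw [mul_comm, mul_smul, hc, SmashOver.mk_smul, hd]

theorem IsGen.of_bijective {m : M} (hm : IsGen A m) (f : M → N) (hf : Function.Bijective f)
    (hs : ∀ (a : A) m, f (a • m) = a • f m) : IsGen A (f m) := by
  have : (fun a : A => a • f m) = f ∘ fun a : A => a • m := funext fun a => (hs a m).symm
  unfold IsGen
  rw [this]
  exact hf.comp hm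

end Algebra

/-! ### Generators of invertible sheaves -/

namespace ASet

open MonoidedSpace

variable {X Y : MonoidedSpace.{u}} {L M N : ASet X}

theorem isGen_gen {U : Opens X.carrier} (e : IsoOn U L (unit X)) {x : X.carrier} (hx : x ∈ U) :
    IsGen (X.stalk x) (germ hx (gen e)) := by
  refine ⟨Function.LeftInverse.injective (g := coord e x) fun a => ?_, fun l =>
    ⟨_, coord_smul_gen e hx l⟩⟩
  rw [coord_smul e hx, coord_gen, mul_one]

theorem IsInvertible.exists_isGen (hL : L.IsInvertible) (x : X.carrier) :
    ∃ l : L.stalk x, IsGen (X.stalk x) l := by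
  obtain ⟨U, hU, ⟨e⟩⟩ := hL x
  exact ⟨_, isGen_gen e hU⟩

/-- A section which generates all stalks trivializes the sheaf. -/
theorem nonempty_isoOn_unit {U : Opens X.carrier} (g : L.Γ U)
    (hg : ∀ x (hx : x ∈ U), IsGen (X.stalk x) (germ hx g)) :
    Nonempty (IsoOn U L (unit X)) := by
  classical
  let φ : ∀ x, (unit X).stalk x → L.stalk x := fun x (a : X.stalk x) =>
    if hx : x ∈ U then a • germ hx g else 0
  have hφ : ∀ x (hx : x ∈ U), φ x = fun a : X.stalk x => a • germ hx g :=
    fun x hx => funext fun a => dif_pos hx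
  have h : Nonempty (IsoOn U (unit X) L) := by
    refine IsoOn.nonempty_of_stalks φ (fun x hx => ?_) (fun x hx a s => ?_)
      (fun V hV (a : X.Γ V) x hx => ⟨V, le_rfl, hx, a • res hV g, fun y hy => ?_⟩)
    · rw [hφ x hx]; exact hg x hx
    · rw [hφ x hx]; exact mul_smul (α := X.stalk x) a s _
    · rw [hφ y (hV hy), germ_smul, germ_res]; rfl
  exact h.map IsoOn.symm

/-! ### Pull-back of invertible sheaves and its compatibility with smash products -/

section Pullback

variable (f : Hom Y X)

/-- The element `1 ∧ l` of the stalk of `f^*L`. -/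
def pullbackStalk (L : ASet X) (y : Y.carrier) (l : L.stalk (f.base y)) :
    (pullback f L).stalk y :=
  (Equiv.ofBijective _ (pullbackValue_bijective y)).symm (.mk _ 1 l)

variable {f}

theorem pullbackValue_pullbackStalk (y : Y.carrier) (l : L.stalk (f.base y)) :
    pullbackValue f L y (pullbackStalk f L y l) = .mk _ 1 l :=
  Equiv.apply_symm_apply (Equiv.ofBijective _ (pullbackValue_bijective y)) _

theorem pullbackStalk_smul (y : Y.carrier) (a : X.stalk (f.base y)) (l : L.stalk (f.base y)) :
    pullbackStalk f L y (a • l) = f.stalkMap y a • pullbackStalk f L y l := by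
  apply (pullbackValue_bijective y).1
  rw [pullbackValue_smul, pullbackValue_pullbackStalk, pullbackValue_pullbackStalk,
    BaseChange.smul_mk, ← BaseChange.mk_mul, mul_comm]

theorem pullbackStalk_germ {V : Opens X.carrier} (l : L.Γ V) {y : Y.carrier}
    (hy : y ∈ f.preim V) : pullbackStalk f L y (germ (Hom.mem_preim.1 hy) l) =
      germ hy (pullbackPure (f := f) (L := L) le_rfl 1 l) := by
  apply (pullbackValue_bijective y).1
  rw [pullbackValue_pure, pullbackValue_pullbackStalk, MonoidedSpace.germ_one]

theorem isGen_pullbackStalk {y : Y.carrier} {l : L.stalk (f.base y)}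
    (hl : IsGen (X.stalk (f.base y)) l) : IsGen (Y.stalk y) (pullbackStalk f L y l) :=
  (BaseChange.isGen (f.stalkMap y) hl).of_bijective _ (Equiv.bijective _) fun a s => by
    rw [Equiv.symm_apply_eq]
    refine Eq.trans ?_ (pullbackValue_smul a _).symm
    exact congrArg _
      (Equiv.apply_symm_apply (Equiv.ofBijective _ (pullbackValue_bijective y)) s).symm

/-- A sheaf `N` of `𝒜_Y`-sets is the pull-back of `L` if there are semilinear maps
`L_{f(y)} → N_y` which locally take sections to sections and take some free generator of
`L_{f(y)}` to a free generator. -/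
theorem nonempty_pullback_iso_of_isGen {N : ASet Y}
    (θ : ∀ y, L.stalk (f.base y) → N.stalk y)
    (hθ : ∀ y a l, θ y (a • l) = f.stalkMap y a • θ y l)
    (hgen : ∀ y, ∃ l, IsGen (X.stalk (f.base y)) l ∧ IsGen (Y.stalk y) (θ y l))
    (hsec : ∀ (V : Opens X.carrier) (l : L.Γ V) (y) (_ : y ∈ f.preim V),
      ∃ (W : Opens Y.carrier) (hW : W ≤ f.preim V) (_ : y ∈ W) (t : N.Γ W),
        ∀ z (hz : z ∈ W), θ z (germ (Hom.mem_preim.1 (hW hz)) l) = germ hz t) :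
    Nonempty (Iso (pullback f L) N) := by
  let φ : ∀ y, BaseChange (f.stalkMap y) (L.stalk (f.base y)) → N.stalk y := fun y =>
    BaseChange.lift (fun b l => b • θ y l) fun a b l => by rw [hθ, mul_smul]
  have hφ : ∀ y b l, φ y (.mk _ b l) = b • θ y l := fun _ _ _ => rfl
  refine IsoOn.nonempty_of_stalks (fun y s => φ y (pullbackValue f L y s))
    (fun y _ => Function.Bijective.comp ?_ (pullbackValue_bijective y)) (fun y _ a s => ?_)
    (fun W hW s y hy => ?_)
  · obtain ⟨l, hl, hl'⟩ := hgen y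
    -- Precomposing with the bijection `b ↦ b • (1 ∧ l)` turns `φ y` into `b ↦ b • θ y l`, which is
    -- bijective because `θ y l` is a free generator.
    refine (Function.Bijective.of_comp_iff (φ y) (BaseChange.isGen (f.stalkMap y) hl)).1 ?_
    have : (φ y ∘ fun b : Y.stalk y => b • BaseChange.mk (f.stalkMap y) 1 l) =
        fun b => b • θ y l := funext fun b => by
      change (b * 1) • θ y l = b • θ y l
      rw [mul_one]
    rw [this]
    exact hl'
  · rw [pullbackValue_smul]
    induction pullbackValue f L y s using BaseChange.ind with | _ b l
    rw [BaseChange.smul_mk, hφ, hφ, mul_smul]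
  · obtain ⟨V, h, hV, U, hU, b, l, e⟩ := exists_pullbackPure s hy
    obtain ⟨W', hW', hy', t, ht⟩ := hsec U l y (hU hV)
    refine ⟨V ⊓ W', inf_le_left.trans h, ⟨hV, hy'⟩,
      (res inf_le_left b : Y.Γ (V ⊓ W')) • (res inf_le_right t : N.Γ (V ⊓ W')), fun z hz => ?_⟩
    rw [← germ_res h hz.1 s, e, pullbackValue_pure, hφ, ht z hz.2, germ_smul, germ_res, germ_res]

/-- The semilinear maps are `l ↦ 1 ∧ e(l)`. Invertibility of `L` supplies the free generators which
the criterion asks for. -/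
theorem nonempty_pullback_congr (f : Hom Y X) (hL : L.IsInvertible) (e : Iso L M) :
    Nonempty (Iso (pullback f L) (pullback f M)) := by
  refine nonempty_pullback_iso_of_isGen (fun y l => pullbackStalk f M y (e.stalkMap _ l))
    (fun y a l => ?_) (fun y => ?_) (fun V l y hy => ⟨_, le_rfl, hy,
      pullbackPure le_rfl 1 (e.toEquiv V le_top l), fun z hz => ?_⟩)
  · rw [e.stalkMap_smul trivial, pullbackStalk_smul]
  · obtain ⟨l, hl⟩ := hL.exists_isGen (f.base y)
    exact ⟨l, hl, isGen_pullbackStalk (hl.of_bijective _ (e.stalkMap_bijective trivial)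
      fun a m => e.stalkMap_smul trivial a m)⟩
  · rw [e.stalkMap_germ le_top, pullbackStalk_germ]

/-- The element `l ∧ m` of the stalk of `L ∧ M`. -/
def smashStalk (L M : ASet X) (x : X.carrier) (l : L.stalk x) (m : M.stalk x) :
    (smash L M).stalk x :=
  (Equiv.ofBijective _ (smashValue_bijective x)).symm (.mk l m)

theorem smashValue_smashStalk (x : X.carrier) (l : L.stalk x) (m : M.stalk x) :
    smashValue L M x (smashStalk L M x l m) = .mk l m :=
  Equiv.apply_symm_apply (Equiv.ofBijective _ (smashValue_bijective x)) _

theorem smashStalk_smul_left (x : X.carrier) (a : X.stalk x) (l : L.stalk x) (m : M.stalk x) :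
    smashStalk L M x (a • l) m = a • smashStalk L M x l m := by
  apply (smashValue_bijective x).1
  rw [smashValue_smul, smashValue_smashStalk, smashValue_smashStalk, SmashOver.smul_mk]

theorem smashStalk_smul_right (x : X.carrier) (a : X.stalk x) (l : L.stalk x) (m : M.stalk x) :
    smashStalk L M x l (a • m) = a • smashStalk L M x l m := by
  apply (smashValue_bijective x).1
  rw [smashValue_smul, smashValue_smashStalk, smashValue_smashStalk, SmashOver.smul_mk,
    SmashOver.mk_smul]

theorem smashStalk_germ {U : Opens X.carrier} {x : X.carrier} (hx : x ∈ U) (l : L.Γ U)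
    (m : M.Γ U) : smashStalk L M x (germ hx l) (germ hx m) = germ hx (pure l m) := by
  apply (smashValue_bijective x).1
  rw [smashValue_pure, smashValue_smashStalk]

theorem isGen_smashStalk {x : X.carrier} {l : L.stalk x} {m : M.stalk x}
    (hl : IsGen (X.stalk x) l) (hm : IsGen (X.stalk x) m) :
    IsGen (X.stalk x) (smashStalk L M x l m) :=
  (SmashOver.isGen hl hm).of_bijective _ (Equiv.bijective _) fun a s => by
    rw [Equiv.symm_apply_eq]
    refine Eq.trans ?_ (smashValue_smul a _).symm
    exact congrArg _
      (Equiv.apply_symm_apply (Equiv.ofBijective _ (smashValue_bijective x)) s).symm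

/-- The semilinear maps are `l ∧ m ↦ (1 ∧ l) ∧ (1 ∧ m)`; if `l` and `m` are free generators, then so
are both sides. -/
theorem nonempty_pullback_smash (f : Hom Y X) (hL : L.IsInvertible) (hM : M.IsInvertible) :
    Nonempty (Iso (pullback f (smash L M)) (smash (pullback f L) (pullback f M))) := by
  let τ : ∀ y, SmashOver (X.stalk (f.base y)) (L.stalk (f.base y)) (M.stalk (f.base y)) →
      (smash (pullback f L) (pullback f M)).stalk y := fun y =>
    SmashOver.lift (fun l m => smashStalk _ _ y (pullbackStalk f L y l) (pullbackStalk f M y m))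
      fun a l m => by
        rw [pullbackStalk_smul, pullbackStalk_smul, smashStalk_smul_left, smashStalk_smul_right]
  have hτ : ∀ y l m, τ y (.mk l m) =
    smashStalk _ _ y (pullbackStalk f L y l) (pullbackStalk f M y m) := fun _ _ _ => rfl
  refine nonempty_pullback_iso_of_isGen (fun y s => τ y (smashValue L M _ s))
    (fun y a s => ?_) (fun y => ?_) (fun V s y hy => ?_)
  · rw [smashValue_smul]
    induction smashValue L M (f.base y) s using SmashOver.ind with | _ l m
    rw [SmashOver.smul_mk, hτ, hτ, pullbackStalk_smul, smashStalk_smul_left]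
  · obtain ⟨l, hl⟩ := hL.exists_isGen (f.base y)
    obtain ⟨m, hm⟩ := hM.exists_isGen (f.base y)
    refine ⟨_, isGen_smashStalk hl hm, ?_⟩
    rw [smashValue_smashStalk, hτ]
    exact isGen_smashStalk (isGen_pullbackStalk hl) (isGen_pullbackStalk hm)
  · obtain ⟨W, h, hW, l, m, e⟩ := exists_pure s (Hom.mem_preim.1 hy)
    refine ⟨f.preim W, fun z hz => h hz, hW,
      pure (pullbackPure le_rfl 1 l) (pullbackPure le_rfl 1 m), fun z hz => ?_⟩
    have hz' : f.base z ∈ W := hz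
    rw [← germ_res h hz' s, e, smashValue_pure, hτ, pullbackStalk_germ l hz,
      pullbackStalk_germ m hz, smashStalk_germ]

end Pullback

end ASet

/-! ### The pull-back homomorphism of Picard groups -/

namespace Pic

/-- Pull-back as a homomorphism of Picard groups. -/
def pullback {X Y : MonoidedSpace.{u}} (f : MonoidedSpace.Hom Y X) : Pic X →* Pic Y :=
  MonoidHom.mk' (_root_.Quotient.map (fun L => L.pullback f)
    fun L _ ⟨e⟩ => ASet.nonempty_pullback_congr f L.2 e)
    (ind fun L => ind fun M => mk_eq.2 (ASet.nonempty_pullback_smash f L.2 M.2))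

end Pic

/-! ### Specialization maps of stalks -/

section Specialize

variable {X : TopCat.{u}} {F : TopCat.Sheaf (Type u) X} {x y : X}

/-- The map of stalks `F_y → F_x` for a specialization `y` of `x`. -/
def specialize (h : x ⤳ y) (t : Stk F y) : Stk F x := F.presheaf.stalkSpecializes h t

theorem specialize_germ (h : x ⤳ y) {U : Opens X} (hy : y ∈ U) (s : Sec F U) :
    specialize h (germ hy s) = germ (h.mem_open U.isOpen hy) s :=
  ConcreteCategory.congr_hom (F.presheaf.germ_stalkSpecializes hy h) s

end Specialize

/-! ### The origin of the affine line -/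

namespace AffineLine

/-- The free pointed monoid on one generator. -/
abbrev Coord : Type u := ULift.{u} (WithZero (Multiplicative ℕ))

/-- Exponents of `t` are natural numbers, so two of them with sum `0` both vanish; a factor `0` is
excluded since `0 ≠ 1`. -/
theorem Coord.eq_one_of_mul_eq_one {a b : Coord.{u}} (h : a * b = 1) : b = 1 := by
  obtain ⟨a⟩ := a
  obtain ⟨b⟩ := b
  have h' : a * b = 1 := congrArg ULift.down h
  refine congrArg ULift.up ?_
  induction a with
  | zero => simp at h'
  | coe a =>
    induction b with
    | zero => simp at h'
    | coe b =>
      rw [← WithZero.coe_mul, ← WithZero.coe_one, WithZero.coe_inj] at h'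
      rw [← WithZero.coe_one, WithZero.coe_inj]
      have : a.toAdd + b.toAdd = 0 := h'
      change b.toAdd = 0
      omega

theorem Coord.eq_zero_or_eq_zero {a b : Coord.{u}} (h : a * b = 0) : a = 0 ∨ b = 0 := by
  obtain ⟨a⟩ := a
  obtain ⟨b⟩ := b
  have h' : a * b = 0 := congrArg ULift.down h
  exact (mul_eq_zero.1 h').imp (congrArg ULift.up) (congrArg ULift.up)

/-- The closed point `t = 0` of the affine line. -/
def origin : affineLine.{u}.carrier :=
  (⟨{a | a ≠ 1}, fun h => zero_ne_one (congrArg ULift.down h),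
    fun _ _ hx h => hx (Coord.eq_one_of_mul_eq_one h), fun h => h rfl,
    -- An element outside the ideal equals `1`, so a product of two such elements is again `1`.
    fun {x y} h => by
      by_contra! hxy
      simp only [Set.mem_ofPred_eq, not_not] at hxy
      exact h (by rw [hxy.1, hxy.2, mul_one])⟩ : PrimeIdeal Coord.{u})

/-- Localizing at the origin inverts nothing but `1`. This is what identifies the stalk there with
`T`. -/
theorem eq_one_of_mem_primeCompl {a : Coord.{u}}
    (h : a ∈ PrimeIdeal.primeCompl (origin : PrimeIdeal Coord.{u})) : a = 1 :=
  not_not.1 h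

/-- The basic open set `D(a)` contains the origin only for `a = 1`, and `D(1)` is everything. The
property passes to finite intersections and to unions. -/
theorem eq_univ_of_isOpen {U : Set affineLine.{u}.carrier} (hU : IsOpen U)
    (h : origin ∈ U) : U = Set.univ := by
  change GenerateOpen _ U at hU
  induction hU with
  | basic s hs =>
    obtain ⟨a, rfl⟩ := hs
    have : a = 1 := eq_one_of_mem_primeCompl h
    exact Set.eq_univ_of_forall fun p => by
      rw [this]; exact PrimeIdeal.one_notMem p
  | univ => rfl
  | inter s t _ _ hs ht => rw [hs h.1, ht h.2, Set.univ_inter]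
  | sUnion S _ ih =>
    obtain ⟨s, hs, hos⟩ := h
    exact Set.eq_univ_of_univ_subset (ih s hs hos ▸ Set.subset_sUnion_of_mem hs)

theorem specializes_origin (v : affineLine.{u}.carrier) : v ⤳ origin :=
  specializes_iff_forall_open.2 fun U hU h => by rw [eq_univ_of_isOpen hU h]; trivial

/-- The global function on the affine line given by an element of the monoid. -/
def const (a : Coord.{u}) : affineLine.{u}.Γ ⊤ :=
  ⟨fun _ => Localization.mk a 1,
    TopCat.PrelocalPredicate.sheafifyOf ⟨a, 1, fun _ => ⟨one_mem _, rfl⟩⟩⟩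

/-- Its germ at the origin. -/
def constGerm (a : Coord.{u}) : affineLine.{u}.stalk origin := germ (Opens.mem_top _) (const a)

theorem constGerm_mul (a b : Coord.{u}) : constGerm (a * b) = constGerm a * constGerm b := by
  have h : const (a * b) = const a * const b := Subtype.ext (funext fun p => by
    change Localization.mk (a * b) 1 = Localization.mk a 1 * Localization.mk b 1
    rw [Localization.mk_mul, mul_one])
  exact (congrArg (germ (Opens.mem_top _)) h).trans (MonoidedSpace.germ_mul _ _ _)

theorem constGerm_one : constGerm (1 : Coord.{u}) = 1 := by
  have h : const (1 : Coord.{u}) = 1 := Subtype.ext (funext fun _ => Localization.mk_one)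
  exact (congrArg (germ (Opens.mem_top _)) h).trans (MonoidedSpace.germ_one _)

theorem constGerm_zero : constGerm (0 : Coord.{u}) = 0 := by
  have h : const (0 : Coord.{u}) = 0 := Subtype.ext (funext fun _ => Localization.mk_zero _)
  exact (congrArg (germ (Opens.mem_top _)) h).trans (MonoidedSpace.germ_zero _)

/-- The value at the origin is the fraction `a / 1`, and equality of fractions there is tested only
against the multiplier `1`. -/
theorem constGerm_injective : Function.Injective constGerm.{u} := by
  intro a b h
  have h' := congrArg (value (P := fractionPre Coord.{u}) origin) h
  rw [constGerm, constGerm] at h'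
  have h'' : (Localization.mk a 1 : Localization
      (PrimeIdeal.primeCompl (origin : PrimeIdeal Coord.{u}))) = Localization.mk b 1 :=
    (value_germ _ _).symm.trans (h'.trans (value_germ _ _))
  rw [Localization.mk_eq_mk_iff, Localization.r_iff_exists] at h''
  obtain ⟨⟨c, hc⟩, h⟩ := h''
  have hc' := eq_one_of_mem_primeCompl hc
  simpa [hc'] using h

theorem constGerm_surjective : Function.Surjective constGerm.{u} := by
  intro t
  obtain ⟨U, hU, s, rfl⟩ := exists_germ t
  obtain ⟨V, hV, i, a, b, h⟩ := s.2 ⟨origin, hU⟩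
  refine ⟨a, ?_⟩
  refine (germ_res le_top hV (const a)).symm.trans (Eq.trans ?_ (germ_res i.le hV s))
  refine congrArg _ (Subtype.ext (funext fun p => ?_))
  -- The denominator lies outside the ideal of the origin, hence is `1`; the same representation `a
  -- / 1` then holds at every point of `V`.
  obtain ⟨hb, -⟩ := h ⟨origin, hV⟩
  have hb' := eq_one_of_mem_primeCompl hb
  subst hb'
  obtain ⟨_, hp⟩ := h p
  exact hp.symm

instance : Nontrivial (affineLine.{u}.stalk origin) :=
  ⟨0, 1, by
    rw [← constGerm_zero, ← constGerm_one]
    exact fun h => zero_ne_one (congrArg ULift.down (constGerm_injective h))⟩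

instance : NoZeroDivisors (affineLine.{u}.stalk origin) where
  eq_zero_or_eq_zero_of_mul_eq_zero {s t} h := by
    obtain ⟨a, rfl⟩ := constGerm_surjective s
    obtain ⟨b, rfl⟩ := constGerm_surjective t
    rw [← constGerm_mul, ← constGerm_zero] at h
    rw [← constGerm_zero]
    exact (Coord.eq_zero_or_eq_zero (constGerm_injective h)).imp (congrArg _) (congrArg _)

theorem eq_one_of_mul_eq_one {s t : affineLine.{u}.stalk origin} (h : s * t = 1) : t = 1 := by
  obtain ⟨a, rfl⟩ := constGerm_surjective s
  obtain ⟨b, rfl⟩ := constGerm_surjective t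
  rw [← constGerm_mul, ← constGerm_one] at h
  rw [← constGerm_one, Coord.eq_one_of_mul_eq_one (constGerm_injective h)]

end AffineLine

/-! ### Stalks of products -/

namespace MonoidedSpace

variable {X Y : MonoidedSpace.{u}}

/-- The canonical map from the stalk of the product to the smash product of the stalks. -/
def prodValue (X Y : MonoidedSpace.{u}) (z : (X.prod Y).carrier) :
    (X.prod Y).stalk z → SmashMonoid (X.stalk z.1) (Y.stalk z.2) :=
  value (P := prodPre X Y) z

theorem prodValue_germ {W : Opens (X.prod Y).carrier} {z : (X.prod Y).carrier} (hz : z ∈ W)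
    (s : (X.prod Y).Γ W) : prodValue X Y z (germ hz s) = s.1 ⟨z, hz⟩ := value_germ hz s

theorem prodValue_mul {z : (X.prod Y).carrier} (s t : (X.prod Y).stalk z) :
    prodValue X Y z (s * t) = prodValue X Y z s * prodValue X Y z t := by
  obtain ⟨U, hU, a, b, rfl, rfl⟩ := exists_germ₂ s t
  rw [← germ_mul, prodValue_germ, prodValue_germ, prodValue_germ]
  rfl

theorem prodValue_one (z : (X.prod Y).carrier) : prodValue X Y z 1 = 1 :=
  (congrArg _ (germ_one (Opens.mem_top z)).symm).trans (prodValue_germ (Opens.mem_top z) 1)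

/-- Sections of the product are locally of the form `a ∧ b`. -/
theorem exists_prod_section {W : Opens (X.prod Y).carrier} (s : (X.prod Y).Γ W)
    {z : (X.prod Y).carrier} (hz : z ∈ W) :
    ∃ (U : Opens X.carrier) (V : Opens Y.carrier) (_ : z.1 ∈ U) (_ : z.2 ∈ V) (a : X.Γ U)
      (b : Y.Γ V), ∀ w : (X.prod Y).carrier, ∀ (hU : w.1 ∈ U) (hV : w.2 ∈ V), ∃ hw : w ∈ W,
        s.1 ⟨w, hw⟩ = .mk (germ hU a) (germ hV b) := by
  obtain ⟨W', hW', i, U, V, hU, hV, a, b, h⟩ := s.2 ⟨z, hz⟩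
  obtain ⟨U', V', hU', hV', h1, h2, h3⟩ := isOpen_prod_iff.1 W'.isOpen z.1 z.2 hW'
  refine ⟨U ⊓ ⟨U', hU'⟩, V ⊓ ⟨V', hV'⟩, ⟨hU ⟨z, hW'⟩, h1⟩, ⟨hV ⟨z, hW'⟩, h2⟩,
    res inf_le_left a, res inf_le_left b, fun w hwU hwV => ?_⟩
  have hw : w ∈ W' := h3 ⟨hwU.2, hwV.2⟩
  refine ⟨i.le hw, (h ⟨w, hw⟩).trans ?_⟩
  rw [germ_res, germ_res]

/-- Elements `a ∧ b` and `a' ∧ b'` agree either because both components agree or because each has a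
vanishing component. Each of these equalities of germs spreads to a neighbourhood in its own factor.
In the second case the vanishing component may be the first on one side and the second on the other,
so the two sides are treated separately and the neighbourhoods intersected. -/
theorem prodValue_injective (z : (X.prod Y).carrier) : Function.Injective (prodValue X Y z) := by
  intro s t h
  obtain ⟨W, hz, s, t, rfl, rfl⟩ := exists_germ₂ s t
  rw [prodValue_germ, prodValue_germ] at h
  obtain ⟨U, V, hU, hV, a, b, hs⟩ := exists_prod_section s hz
  obtain ⟨U', V', hU', hV', a', b', ht⟩ := exists_prod_section t hz
  obtain ⟨_, hs'⟩ := hs z hU hV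
  obtain ⟨_, ht'⟩ := ht z hU' hV'
  rw [hs', ht', SmashMonoid.mk_eq_iff] at h
  -- It suffices to have equality of the two representations on a box `A × B` around `z`.
  suffices key : ∃ (A : Opens X.carrier) (B : Opens Y.carrier) (_ : z.1 ∈ A) (_ : z.2 ∈ B),
      A ≤ U ⊓ U' ∧ B ≤ V ⊓ V' ∧ ∀ w : (X.prod Y).carrier, ∀ (_ : w.1 ∈ A) (_ : w.2 ∈ B)
        (h1 : w.1 ∈ U) (h2 : w.1 ∈ U') (h3 : w.2 ∈ V) (h4 : w.2 ∈ V'),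
        (SmashMonoid.mk (germ h1 a) (germ h3 b) : SmashMonoid (X.stalk w.1) (Y.stalk w.2)) =
          .mk (germ h2 a') (germ h4 b') by
    obtain ⟨A, B, hA, hB, hAU, hBV, h⟩ := key
    let O : Opens (X.prod Y).carrier :=
      ⟨(A : Set X.carrier) ×ˢ (B : Set Y.carrier), A.isOpen.prod B.isOpen⟩
    have hO : O ≤ W := fun w hw => (hs w (hAU hw.1).1 (hBV hw.2).1).1
    have hzO : z ∈ O := ⟨hA, hB⟩
    rw [← germ_res hO hzO s, ← germ_res hO hzO t]
    refine congrArg _ (Subtype.ext (funext fun w => ?_))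
    obtain ⟨_, h1⟩  := hs w.1 (hAU w.2.1).1 (hBV w.2.2).1
    obtain ⟨_, h2⟩ := ht w.1 (hAU w.2.1).2 (hBV w.2.2).2
    exact h1.trans ((h w.1 w.2.1 w.2.2 _ _ _ _).trans h2.symm)
  have zeroX : ∀ {U : Opens X.carrier} (hU : z.1 ∈ U) (a : X.Γ U), germ hU a = 0 →
      ∃ A ≤ U, z.1 ∈ A ∧ ∀ x (_ : x ∈ A) (hx : x ∈ U), germ hx a = 0 := by
    intro U hU a ha
    obtain ⟨A, hA, i, j, e⟩ := germ_eq (ha.trans (germ_zero hU).symm)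
    exact ⟨A, i, hA, fun x hx hx' => by rw [← germ_res i hx, e, germ_res, germ_zero]⟩
  have zeroY : ∀ {U : Opens Y.carrier} (hU : z.2 ∈ U) (a : Y.Γ U), germ hU a = 0 →
      ∃ A ≤ U, z.2 ∈ A ∧ ∀ x (_ : x ∈ A) (hx : x ∈ U), germ hx a = 0 := by
    intro U hU a ha
    obtain ⟨A, hA, i, j, e⟩ := germ_eq (ha.trans (germ_zero hU).symm)
    exact ⟨A, i, hA, fun x hx hx' => by rw [← germ_res i hx, e, germ_res, germ_zero]⟩
  have zero : ∀ {U : Opens X.carrier} {V : Opens Y.carrier} (hU : z.1 ∈ U) (hV : z.2 ∈ V)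
      (a : X.Γ U) (b : Y.Γ V), germ hU a = 0 ∨ germ hV b = 0 → ∃ A ≤ U, ∃ B ≤ V, z.1 ∈ A ∧
        z.2 ∈ B ∧ ∀ x y (_ : x ∈ A) (_ : y ∈ B) (hx : x ∈ U) (hy : y ∈ V),
          germ hx a = 0 ∨ germ hy b = 0 := by
    rintro U V hU hV a b (h | h)
    · obtain ⟨A, hA, hzA, h⟩ := zeroX hU a h
      exact ⟨A, hA, V, le_rfl, hzA, hV, fun x y hx _ hx' _ => .inl (h x hx hx')⟩
    · obtain ⟨B, hB, hzB, h⟩ := zeroY hV b h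
      exact ⟨U, le_rfl, B, hB, hU, hzB, fun x y _ hy _ hy' => .inr (h y hy hy')⟩
  rcases h with ⟨h, h'⟩ | ⟨h, h'⟩
  · obtain ⟨A, hA, i, j, e⟩ := germ_eq h
    obtain ⟨B, hB, i', j', e'⟩ := germ_eq h'
    refine ⟨A, B, hA, hB, le_inf i j, le_inf i' j', fun w hwA hwB h1 h2 h3 h4 => ?_⟩
    rw [← germ_res i hwA, e, germ_res, ← germ_res i' hwB, e', germ_res]
  · obtain ⟨A, hA, B, hB, hzA, hzB, k⟩ := zero hU hV a b h
    obtain ⟨A', hA', B', hB', hzA', hzB', k'⟩ := zero hU' hV' a' b' h'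
    refine ⟨A ⊓ A', B ⊓ B', ⟨hzA, hzA'⟩, ⟨hzB, hzB'⟩, inf_le_inf hA hA', inf_le_inf hB hB',
      fun w hwA hwB h1 h2 h3 h4 => ?_⟩
    exact SmashMonoid.mk_eq_iff.2 (.inr ⟨k _ _ hwA.1 hwB.1 _ _, k' _ _ hwA.2 hwB.2 _ _⟩)

theorem prodValue_stalkMap_fst {z : (X.prod Y).carrier} (a : X.stalk z.1) :
    prodValue X Y z ((X.fst Y).stalkMap z a) = .mk a 1 := by
  obtain ⟨U, hU, a, rfl⟩ := exists_germ a
  exact (congrArg _ (Hom.stalkMap_germ (f := X.fst Y) hU a)).trans (prodValue_germ _ _)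

end MonoidedSpace

/-! ### Cylinders over a monoided space -/

namespace SmashMonoid

variable {A B : Type u} [CommMonoidWithZero A] [CommMonoidWithZero B] [Nontrivial B]

/-- Either the product of the `B`-components is `1`, so that the `B`-component of `t` is `1`, or `1
∧ 1` is the zero element. As `B` is nontrivial, the latter forces `1 = 0` in `A`, so that `t` is
zero, that is, `0 ∧ 1`. -/
theorem exists_eq_mk_one (hB : ∀ {s t : B}, s * t = 1 → t = 1) {s t : SmashMonoid A B}
    (h : s * t = 1) : ∃ a, t = mk a 1 := by
  induction s using ind with | _ a b
  induction t using ind with | _ a' b'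
  rcases mk_eq_iff.1 ((mk_mul a a' b b').symm.trans h) with ⟨-, h⟩ | ⟨-, h | h⟩
  · exact ⟨a', by rw [hB h]⟩
  · exact ⟨0, mk_eq_iff.2 (.inr ⟨.inl (by rw [← mul_one a', h, mul_zero]), .inl rfl⟩)⟩
  · exact absurd h one_ne_zero

variable [NoZeroDivisors B]

open Classical in
/-- The retraction `A ∧ B → A` which sends the nonzero elements of `B` to `1`. -/
def retract (A B : Type u) [CommMonoidWithZero A] [CommMonoidWithZero B] [Nontrivial B]
    [NoZeroDivisors B] : SmashMonoid A B →* A where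
  toFun := Quot.lift (fun p : A × B => if p.2 = 0 then 0 else p.1) (by
    rintro ⟨a, b⟩ ⟨a', b'⟩ (h | ⟨h, h'⟩)
    · rw [h]
    · have key : ∀ (a : A) (b : B), a = 0 ∨ b = 0 → (if b = 0 then 0 else a) = 0 := by
        rintro a b (h | h)
        · rw [h, ite_self]
        · rw [if_pos h]
      exact (key a b h).trans (key a' b' h').symm)
  map_one' := if_neg one_ne_zero
  map_mul' := ind fun a b => ind fun a' b' => by
    change (if b * b' = 0 then 0 else a * a') =
      (if b = 0 then 0 else a) * (if b' = 0 then 0 else a')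
    by_cases hb : b = 0
    · rw [hb, zero_mul, if_pos rfl, if_pos rfl, zero_mul]
    by_cases hb' : b' = 0
    · rw [hb', mul_zero, if_pos rfl, if_pos rfl, mul_zero]
    -- Multiplicativity depends here on `B` having no zero divisors.
    rw [if_neg (mul_ne_zero hb hb'), if_neg hb, if_neg hb']

theorem retract_mk_zero (a : A) : retract A B (mk a 0) = 0 := if_pos rfl

theorem retract_mk_of_ne_zero (a : A) {b : B} (hb : b ≠ 0) : retract A B (mk a b) = a :=
  if_neg hb

end SmashMonoid

/-! ### The cylinder along its zero section -/

namespace MonoidedSpace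

open AffineLine

/-- The product `X × 𝔸¹`. -/
abbrev cylinder (X : MonoidedSpace.{u}) : MonoidedSpace.{u} := X.prod affineLine

/-- The projection `X × 𝔸¹ → X`. -/
abbrev proj (X : MonoidedSpace.{u}) : Hom X.cylinder X := X.fst affineLine

variable {X : MonoidedSpace.{u}}

/-- The point of the zero section over `x`. -/
def zeroPt (x : X.carrier) : X.cylinder.carrier := (x, origin)

theorem specializes_zeroPt (y : X.cylinder.carrier) : y ⤳ zeroPt (X.proj.base y) :=
  Specializes.prod (specializes_refl y.1) (specializes_origin y.2)

/-- A box around `(x, 0)` has as its second factor a neighbourhood of the origin, which is the whole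
affine line. -/
theorem exists_preim_le {W : Opens X.cylinder.carrier} {x : X.carrier} (h : zeroPt x ∈ W) :
    ∃ U : Opens X.carrier, x ∈ U ∧ X.proj.preim U ≤ W := by
  obtain ⟨U, V, hU, hV, hx, ho, hUV⟩ := isOpen_prod_iff.1 W.isOpen x origin h
  refine ⟨⟨U, hU⟩, hx, fun z hz => hUV ⟨hz, ?_⟩⟩
  rw [eq_univ_of_isOpen hV ho]
  trivial

theorem prodValue_stalkMap_zeroPt (x : X.carrier) (a : X.stalk x) :
    prodValue X affineLine (zeroPt x) (X.proj.stalkMap (zeroPt x) a) = .mk a 1 :=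
  prodValue_stalkMap_fst (z := zeroPt x) a

/-- The element `a ∧ 1` determines `a`: since `1 ≠ 0` in the stalk at the origin, it is zero only
for `a = 0`. -/
theorem stalkMap_zeroPt_injective (x : X.carrier) :
    Function.Injective (X.proj.stalkMap (zeroPt x)) := by
  intro a b h
  have h' := SmashMonoid.mk_eq_iff.1 ((prodValue_stalkMap_zeroPt x a).symm.trans
    ((congrArg _ h).trans (prodValue_stalkMap_zeroPt x b)))
  have h1 : (1 : affineLine.{u}.stalk origin) ≠ 0 := one_ne_zero
  rcases h' with ⟨h, -⟩ | ⟨h | h, h' | h'⟩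
  · exact h
  · exact h.trans h'.symm
  all_goals first | exact absurd h h1 | exact absurd h' h1

/-- In `𝒜_x ∧ T` a unit has the form `a ∧ 1`, because `T` has no unit besides `1`. Injectivity of
`prodValue` carries this back to the stalk of the product. -/
theorem exists_stalkMap_of_mul_eq_one {x : X.carrier} {s t : X.cylinder.stalk (zeroPt x)}
    (h : s * t = 1) : ∃ a : X.stalk x, X.proj.stalkMap (zeroPt x) a = t := by
  have h' : prodValue X affineLine _ s * prodValue X affineLine _ t = 1 := by
    rw [← prodValue_mul, h, prodValue_one]
  obtain ⟨a, ha⟩ := SmashMonoid.exists_eq_mk_one (B := affineLine.{u}.stalk origin)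
    eq_one_of_mul_eq_one h'
  exact ⟨a, prodValue_injective _ ((prodValue_stalkMap_zeroPt x a).trans ha.symm)⟩

/-- A retraction of `𝒜_x → 𝒜_{(x, 0)}`. -/
def stalkRetract (x : X.carrier) : X.cylinder.stalk (zeroPt x) →* X.stalk x where
  toFun s := SmashMonoid.retract (X.stalk x) (affineLine.{u}.stalk origin)
    (prodValue X affineLine (zeroPt x) s)
  map_one' := by rw [prodValue_one]; exact map_one _
  map_mul' s t := by rw [prodValue_mul]; exact map_mul _ _ _

theorem stalkRetract_stalkMap (x : X.carrier) (a : X.stalk x) :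
    stalkRetract x (X.proj.stalkMap (zeroPt x) a) = a := by
  refine (congrArg (SmashMonoid.retract (X.stalk x) (affineLine.{u}.stalk origin))
    (prodValue_stalkMap_zeroPt x a)).trans ?_
  exact SmashMonoid.retract_mk_of_ne_zero a (one_ne_zero (α := affineLine.{u}.stalk origin))

/-- Shows that the stalkwise retraction takes sections to sections. Near `(x, 0)` the section is `a
∧ b`, and the germ of `b` at the origin does not depend on `y`: the retraction gives `0` at every
`y` if this germ vanishes, and `a` at every `y` otherwise. -/
theorem exists_stalkRetract_germ {V : Opens X.carrier} (s : X.cylinder.Γ (X.proj.preim V))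
    {x : X.carrier} (hx : x ∈ V) : ∃ (W : Opens X.carrier) (hW : W ≤ V) (_ : x ∈ W) (a : X.Γ W),
      ∀ y (hy : y ∈ W), stalkRetract y (germ (show zeroPt y ∈ X.proj.preim V from hW hy) s) =
        germ hy a := by
  obtain ⟨U, V', hU, hV', a, b, h⟩ := exists_prod_section s (z := zeroPt x) hx
  have hUV : U ≤ V := fun y hy => (h (zeroPt y) hy hV').1
  have hr : ∀ y (hy : y ∈ U), stalkRetract y (germ (show zeroPt y ∈ X.proj.preim V from hUV hy) s)
      = SmashMonoid.retract (X.stalk y) (affineLine.{u}.stalk origin)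
        (.mk (germ hy a) (germ hV' b)) := fun y hy => by
    obtain ⟨hw, e⟩ := h (zeroPt y) hy hV'
    exact congrArg _ ((prodValue_germ hw s).trans e)
  by_cases hb : (germ hV' b : affineLine.{u}.stalk origin) = 0
  · refine ⟨U, hUV, hU, 0, fun y hy => ?_⟩
    rw [hr y hy, germ_zero]
    exact (congrArg (fun t => SmashMonoid.retract _ (affineLine.{u}.stalk origin) (.mk _ t))
      hb).trans (SmashMonoid.retract_mk_zero _)
  · exact ⟨U, hUV, hU, a, fun y hy =>
      (hr y hy).trans (SmashMonoid.retract_mk_of_ne_zero _ hb)⟩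

end MonoidedSpace

/-! ### Injectivity: trivial pull-backs come from trivial sheaves -/

namespace ASet

open MonoidedSpace

variable {X : MonoidedSpace.{u}}

/-- An invertible sheaf is trivial if its pull-back to the cylinder is. -/
theorem nonempty_iso_unit_of_pullback {L : ASet X} (hL : L.IsInvertible)
    (e : Iso (pullback X.proj L) (unit X.cylinder)) : Nonempty (Iso L (unit X)) := by
  -- The value of the trivialization on `1 ∧ l` at the point `(x, 0)`; it is semilinear over `𝒜_x`,
  -- and the retraction makes it linear with values in `𝒜_x`.
  let ψ : ∀ x, L.stalk x → X.cylinder.stalk (zeroPt x) := fun x l =>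
    e.stalkMap (zeroPt x) (pullbackStalk X.proj L (zeroPt x) l)
  have hψ : ∀ x (a : X.stalk x) l, ψ x (a • l) = X.proj.stalkMap (zeroPt x) a * ψ x l :=
    fun x a l => (congrArg _ (pullbackStalk_smul (zeroPt x) a l)).trans
      (e.stalkMap_smul trivial _ _)
  have hφ : ∀ x (a : X.stalk x) l,
      stalkRetract x (ψ x (a • l)) = a * stalkRetract x (ψ x l) := fun x a l => by
    rw [hψ, map_mul, stalkRetract_stalkMap]
  refine IsoOn.nonempty_of_stalks (fun x l => stalkRetract x (ψ x l)) (fun x _ => ?_)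
    (fun x _ => hφ x) (fun V hV s x hx => ?_)
  · obtain ⟨l, hl⟩ := hL.exists_isGen x
    have hg : IsGen (X.cylinder.stalk (zeroPt x)) (e.stalkMap (zeroPt x) _) :=
      (isGen_pullbackStalk (f := X.proj) (y := zeroPt x) hl).of_bijective _
        (e.stalkMap_bijective trivial) fun a m => e.stalkMap_smul trivial a m
    -- A free generator of the structure sheaf's stalk is a unit, with inverse `v`. Its image under
    -- the multiplicative retraction is then a unit of `𝒜_x`.
    obtain ⟨v, hv⟩ := hg.2 (1 : X.cylinder.stalk (zeroPt x))
    have hv' : v * ψ x l = 1 := hv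
    have hu : stalkRetract x v * stalkRetract x (ψ x l) = 1 := by
      rw [← map_mul, hv', map_one]
    -- In terms of the generator `l` the map becomes multiplication by that unit.
    refine (Function.Bijective.of_comp_iff
      (fun l => stalkRetract x (ψ x l) : L.stalk x → X.stalk x) hl).1 ?_
    have : ((fun l => stalkRetract x (ψ x l)) ∘ fun a : X.stalk x => a • l) =
        fun a => a * stalkRetract x (ψ x l) := funext fun a => hφ x a l
    rw [this]
    refine ⟨fun (a b : X.stalk x) h => ?_, fun (a : X.stalk x) => ⟨a * stalkRetract x v, ?_⟩⟩
    · have h' : a * stalkRetract x (ψ x l) = b * stalkRetract x (ψ x l) := h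
      have := congrArg (· * stalkRetract x v) h'
      simpa only [mul_assoc, mul_comm (stalkRetract x (ψ x l)), hu, mul_one] using this
    · dsimp only
      rw [mul_assoc, hu, mul_one]
  · obtain ⟨W, hW, hxW, a, ha⟩ := exists_stalkRetract_germ
      (show X.cylinder.Γ (X.proj.preim V) from
        e.toEquiv (X.proj.preim V) le_top (pullbackPure le_rfl 1 s)) hx
    refine ⟨W, hW, hxW, a, fun y hy => Eq.trans (congrArg _ ?_) (ha y hy)⟩
    have hy' : zeroPt y ∈ X.proj.preim V := hW hy
    exact (congrArg _ (pullbackStalk_germ s hy')).trans (e.stalkMap_germ le_top hy' _)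

/-! ### Surjectivity: descent along the zero section -/

section Descent

/-- The stalk of `M` at the point of the zero section over `x`, as an `𝒜_x`-set. -/
def ZeroStalk (M : ASet X.cylinder) (x : X.carrier) : Type u := M.stalk (zeroPt x)

variable (M : ASet X.cylinder)

instance (x : X.carrier) : Zero (ZeroStalk M x) := inferInstanceAs (Zero (M.stalk (zeroPt x)))

instance (x : X.carrier) : MulActionWithZero (X.stalk x) (ZeroStalk M x) :=
  MulActionWithZero.compHom (M.stalk (zeroPt x)) (X.proj.stalkMap (zeroPt x))

variable {M}

/-- The germ on the zero section. -/
def zeroGerm {U : Opens X.carrier} {x : X.carrier} (hx : x ∈ U) (g : M.Γ (X.proj.preim U)) :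
    ZeroStalk M x := germ (show zeroPt x ∈ X.proj.preim U from hx) g

theorem ZeroStalk.smul_def {x : X.carrier} (a : X.stalk x) (m : ZeroStalk M x) :
    a • m = (X.proj.stalkMap (zeroPt x) a • (show M.stalk (zeroPt x) from m) :
      M.stalk (zeroPt x)) := rfl

theorem preim_mono {U V : Opens X.carrier} (h : U ≤ V) : X.proj.preim U ≤ X.proj.preim V :=
  fun _ hz => h hz

theorem zeroGerm_res {U V : Opens X.carrier} (h : U ≤ V) {x : X.carrier} (hx : x ∈ U)
    (g : M.Γ (X.proj.preim V)) :
    zeroGerm hx (res (preim_mono h) g) = zeroGerm (h hx) g := germ_res _ _ _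

/-- The section `g` freely generates `M`. -/
def Generates {U : Opens X.carrier} (g : M.Γ (X.proj.preim U)) : Prop :=
  ∀ z (hz : z ∈ X.proj.preim U), IsGen (X.cylinder.stalk z) (germ hz g)

theorem Generates.restrict {U V : Opens X.carrier} {g : M.Γ (X.proj.preim V)} (hg : Generates g)
    (h : U ≤ V) : Generates (res (preim_mono h) g) := fun z hz => by
  rw [germ_res]
  exact hg z _

variable (M) in
/-- The families `x ↦ a_x g_{(x, 0)}` for a generator `g` of `M`. -/
def descentPre : TopCat.PrelocalPredicate (ZeroStalk M) where
  -- The zero family is allowed separately: it must satisfy the predicate over all of `X`, where `M`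
  -- need not have a generator.
  pred {U} f := (∀ x : U, f x = 0) ∨ ∃ (a : X.Γ U) (g : M.Γ (X.proj.preim U)), Generates g ∧
    ∀ x : U, f x = germ x.2 a • zeroGerm x.2 g
  res := by
    rintro U V i f (h | ⟨a, g, hg, h⟩)
    · exact .inl fun x => h _
    · refine .inr ⟨res i.le a, res (preim_mono i.le) g, hg.restrict i.le, fun x => ?_⟩
      rw [germ_res, zeroGerm_res i.le]
      exact h _

variable (M) in
/-- The sheaf of those sections of `M` which locally are a function on `X` times a generator. -/
def descent : ASet X :=
  ofFibers (descentPre M) (.inl fun _ => rfl) (by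
    rintro U a f (h | ⟨b, g, hg, h⟩)
    · exact .inl fun x => by
        change germ x.2 a • f x = 0
        rw [h, smul_zero]
    · refine .inr ⟨a * b, g, hg, fun x => ?_⟩
      change germ x.2 a • f x = _
      rw [h, MonoidedSpace.germ_mul, mul_smul])

/-- A trivialization of `M` near `(x, 0)` is defined over a whole tube. -/
theorem IsInvertible.exists_generates (hM : M.IsInvertible) (x : X.carrier) :
    ∃ (U : Opens X.carrier) (_ : x ∈ U) (g : M.Γ (X.proj.preim U)), Generates g := by
  obtain ⟨W, hW, ⟨e⟩⟩ := hM (zeroPt x)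
  obtain ⟨U, hU, h⟩ := exists_preim_le hW
  exact ⟨U, hU, res h (gen e), fun z hz => by
    rw [germ_res]; exact isGen_gen e (h hz)⟩

/-- Two generators differ locally by a function on `X`. -/
theorem Generates.exists_smul_eq {U : Opens X.carrier} {g g' : M.Γ (X.proj.preim U)}
    (hg : Generates g) (hg' : Generates g') {x : X.carrier} (hx : x ∈ U) :
    ∃ (V : Opens X.carrier) (hV : V ≤ U) (_ : x ∈ V) (a : X.Γ V), ∀ y (hy : y ∈ V),
      zeroGerm (hV hy) g' = germ hy a • zeroGerm (hV hy) g := by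
  have hz : zeroPt x ∈ X.proj.preim U := hx
  obtain ⟨b, hb⟩ := (hg _ hz).2 (germ hz g')
  obtain ⟨b', hb'⟩ := (hg' _ hz).2 (germ hz g)
  -- The two generators are multiples of each other, so the factor `b` is a unit of the stalk at
  -- `(x, 0)` and hence comes from `𝒜_x`.
  have h1 : b' * b = 1 := (hg _ hz).1 (by
    dsimp only at hb hb' ⊢
    rw [mul_smul, hb, hb', one_smul])
  obtain ⟨a, rfl⟩ := exists_stalkMap_of_mul_eq_one h1
  obtain ⟨V, hV, hxV, a, rfl⟩ := IsoOn.exists_germ_le hx a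
  have hzV : zeroPt x ∈ X.proj.preim V := hxV
  have h2 : germ hzV (res (preim_mono hV) g') =
      germ hzV (X.proj.comap V a • res (preim_mono hV) g) := by
    rw [germ_res, germ_smul, germ_res, ← Hom.stalkMap_germ]
    exact hb.symm
  obtain ⟨W, hW, i, j, h3⟩ := germ_eq h2
  -- The equality of germs at `(x, 0)` holds on a neighbourhood, which contains the tube over some
  -- `V'`.
  obtain ⟨V', hV', hVW⟩ := exists_preim_le hW
  have hVV : V' ≤ V := fun y hy => i (hVW (show zeroPt y ∈ X.proj.preim V' from hy))
  refine ⟨V', hVV.trans hV, hV', res hVV a, fun y hy => ?_⟩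
  have hyW : zeroPt y ∈ W := hVW (show zeroPt y ∈ X.proj.preim V' from hy)
  have h4 := congrArg (germ hyW) h3
  rw [germ_res, germ_res, germ_res, germ_smul, germ_res] at h4
  refine h4.trans ?_
  rw [ZeroStalk.smul_def, germ_res, ← Hom.stalkMap_germ (f := X.proj) (hVV hy)]
  rfl

/-- The generators in the local descriptions of `s` may vary; by `Generates.exists_smul_eq` they can
all be replaced by the fixed `g`, at the cost of a function on `X`. -/
theorem descent_exists_smul_eq {U : Opens X.carrier}
    (s : (descent M).Γ U) {g : M.Γ (X.proj.preim U)} (hg : Generates g) {x : X.carrier}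
    (hx : x ∈ U) :
    ∃ (V : Opens X.carrier) (hV : V ≤ U) (_ : x ∈ V) (a : X.Γ V), ∀ y (hy : y ∈ V),
      s.1 ⟨y, hV hy⟩ = germ hy a • zeroGerm (hV hy) g := by
  obtain ⟨V, hV, i, h | ⟨a, g', hg', h⟩⟩ := s.2 ⟨x, hx⟩
  · refine ⟨V, i.le, hV, 0, fun y hy => ?_⟩
    rw [MonoidedSpace.germ_zero, zero_smul]
    exact h ⟨y, hy⟩
  · obtain ⟨W, hW, hxW, b, hb⟩ := (hg.restrict i.le).exists_smul_eq hg' hV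
    refine ⟨W, hW.trans i.le, hxW, res hW a * b, fun y hy => (h ⟨y, hW hy⟩).trans ?_⟩
    rw [hb y hy, zeroGerm_res i.le, MonoidedSpace.germ_mul, mul_smul, germ_res]

/-- The section of the descended sheaf given by a generator. -/
def descentSection {U : Opens X.carrier} (g : M.Γ (X.proj.preim U)) (hg : Generates g) :
    (descent M).Γ U :=
  ⟨fun x => zeroGerm x.2 g, TopCat.PrelocalPredicate.sheafifyOf (.inr ⟨1, g, hg, fun x => by
    rw [MonoidedSpace.germ_one, one_smul]⟩)⟩

variable (M) in
/-- The canonical map from the stalk of the descended sheaf to the stalk on the zero section. -/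
def descentValue (x : X.carrier) : (descent M).stalk x → ZeroStalk M x :=
  value (P := descentPre M) x

theorem descentValue_smul {x : X.carrier} (a : X.stalk x) (s : (descent M).stalk x) :
    descentValue M x (a • s) = a • descentValue M x s := value_smul a s

theorem descentValue_germ {U : Opens X.carrier} {x : X.carrier} (hx : x ∈ U)
    (s : (descent M).Γ U) : descentValue M x (germ hx s) = s.1 ⟨x, hx⟩ := value_germ hx s

/-- Freeness: `g` is free over the stalk at `(x, 0)`, and `𝒜_x` injects into that stalk. Generation
is `descent_exists_smul_eq`. -/
theorem isGen_descentSection {U : Opens X.carrier}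
    {g : M.Γ (X.proj.preim U)} (hg : Generates g) {x : X.carrier} (hx : x ∈ U) :
    IsGen (X.stalk x) (germ hx (descentSection g hg)) := by
  constructor
  · intro a b h
    have h' := congrArg (descentValue M x) h
    dsimp only at h'
    rw [descentValue_smul, descentValue_smul, descentValue_germ] at h'
    exact stalkMap_zeroPt_injective x ((hg (zeroPt x) hx).1 h')
  · intro s
    obtain ⟨V, hV, hxV, s, rfl⟩ := IsoOn.exists_germ_le hx s
    obtain ⟨W, hW, hxW, a, ha⟩ := descent_exists_smul_eq s (hg.restrict hV) hxV
    refine ⟨germ hxW a, ?_⟩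
    dsimp only
    rw [← germ_res (hW.trans hV) hxW, ← germ_smul, ← germ_res hW hxW s]
    refine congrArg _ (Subtype.ext (funext fun y => Eq.symm ((ha y.1 y.2).trans ?_)))
    rw [zeroGerm_res hV]
    rfl

theorem IsInvertible.descent (hM : M.IsInvertible) : (descent M).IsInvertible := by
  intro x
  obtain ⟨U, hU, g, hg⟩ := hM.exists_generates x
  exact ⟨U, hU, nonempty_isoOn_unit _ fun y hy => isGen_descentSection hg hy⟩

theorem specialize_smul {Y : MonoidedSpace.{u}} {N : ASet Y} {y z : Y.carrier} (h : y ⤳ z)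
    (b : Y.stalk z) (m : N.stalk z) :
    (specialize h (b • m) : N.stalk y) =
      (specialize h b : Y.stalk y) • (specialize h m : N.stalk y) := by
  obtain ⟨U, hU, b, m, rfl, rfl⟩ := exists_germ₂ b m
  rw [← germ_smul, specialize_germ, specialize_germ, specialize_germ, germ_smul]

/-- A point `y` and the point of the zero section below it have the same image in `X`. Pulling a
germ back to the zero section and then specializing to `y` is the same as pulling it back to `y`. -/
theorem specialize_stalkMap (y : X.cylinder.carrier) (a : X.stalk (X.proj.base y)) :
    (specialize (specializes_zeroPt y) (X.proj.stalkMap (zeroPt (X.proj.base y)) a) :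
      X.cylinder.stalk y) = X.proj.stalkMap y a := by
  obtain ⟨U, hU, a, rfl⟩ := exists_germ a
  refine (congrArg _ (Hom.stalkMap_germ (f := X.proj) (y := zeroPt (X.proj.base y)) hU a)).trans ?_
  rw [specialize_germ, Hom.stalkMap_germ]

/-- An invertible sheaf on the cylinder is a pull-back. -/
theorem IsInvertible.nonempty_pullback_descent_iso (hM : M.IsInvertible) :
    Nonempty (Iso (ASet.pullback X.proj (ASet.descent M)) M) := by
  -- A germ of the descended sheaf lives on the zero section; the specialization map carries it to
  -- the stalk of `M` at `y`.
  let θ : ∀ y : X.cylinder.carrier, (ASet.descent M).stalk (X.proj.base y) → M.stalk y :=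
    fun y l => specialize (specializes_zeroPt y)
      (show M.stalk (zeroPt (X.proj.base y)) from descentValue M _ l)
  refine nonempty_pullback_iso_of_isGen θ (fun y a l => ?_) (fun y => ?_) (fun V l y hy => ?_)
  · dsimp only [θ]
    rw [descentValue_smul, ZeroStalk.smul_def]
    exact (specialize_smul _ _ _).trans (congrArg (· • _) (specialize_stalkMap y a))
  · obtain ⟨U, hU, g, hg⟩ := hM.exists_generates (X.proj.base y)
    refine ⟨_, isGen_descentSection hg hU, ?_⟩
    dsimp only [θ]
    rw [descentValue_germ]
    -- The generator `g` is defined on the whole tube, so specialization returns its germ at `y`,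
    -- which is a free generator because `Generates` concerns all points of the tube.
    have : specialize (specializes_zeroPt y) (zeroGerm hU g) =
        germ (show y ∈ X.proj.preim U from hU) g :=
      specialize_germ _ _ _
    exact (congrArg (IsGen (X.cylinder.stalk y)) this).mpr (hg y hU)
  · obtain ⟨U, hU, g, hg⟩ := hM.exists_generates (X.proj.base y)
    have hyU : X.proj.base y ∈ V ⊓ U := ⟨hy, hU⟩
    -- Locally `l = a g` with `a` a function on `X`, so over the tube above `W` it is represented by
    -- the section `p^*(a) g` of `M`.
    obtain ⟨W, hW, hyW, a, ha⟩ := descent_exists_smul_eq (res inf_le_left l)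
      (hg.restrict (inf_le_right : V ⊓ U ≤ U)) hyU
    refine ⟨X.proj.preim W, preim_mono (hW.trans inf_le_left), hyW,
      X.proj.comap W a • res (preim_mono (hW.trans inf_le_right)) g, fun z hz => ?_⟩
    have hz' : X.proj.base z ∈ W := hz
    dsimp only [θ]
    rw [germ_smul, ← Hom.stalkMap_germ (f := X.proj) hz', germ_res, ← specialize_stalkMap,
      descentValue_germ]
    have h1 := (ha _ hz').trans (congrArg _ (zeroGerm_res inf_le_right (hW hz') g))
    refine (congrArg (specialize (specializes_zeroPt z)) h1).trans ?_
    refine (specialize_smul _ _ _).trans (congrArg _ ?_)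
    exact specialize_germ _ _ _

end Descent

end ASet

theorem Pic.pullback_proj_bijective (X : MonoidedSpace.{u}) :
    Function.Bijective (pullback X.proj) := by
  refine ⟨(injective_iff_map_eq_one _).2 (ind fun L h => ?_), ind fun M => ?_⟩
  · obtain ⟨e⟩ := mk_eq.1 h
    exact mk_eq.2 (ASet.nonempty_iso_unit_of_pullback L.2 e)
  · exact ⟨mk ⟨_, M.2.descent⟩, mk_eq.2 M.2.nonempty_pullback_descent_iso⟩

end

end MonoidScheme

theorem mainTheorem2 (X : MonoidScheme.MonoidedSpace.{u}) (hX : X.IsMonoidScheme) :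
    ∃ e : MonoidScheme.Pic X ≃* MonoidScheme.Pic (X.prod MonoidScheme.affineLine),
      ∀ L : MonoidScheme.InvertibleSheaf X,
        e (MonoidScheme.Pic.mk L) =
          MonoidScheme.Pic.mk (L.pullback (X.fst MonoidScheme.affineLine)) :=
  ⟨MulEquiv.ofBijective _ (MonoidScheme.Pic.pullback_proj_bijective X), fun _ => rfl⟩
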